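/- Let $t>2$ be an integer and let $\gamma=-\Gamma'(1)$ be the Euler--Mascheroni constant. Let $X_1,\dots,X_n$ be independent uniformly random points of $[0,1]^t$, and order $\mathbb R^t$ coordinatewise. A chain of length $\ell$ is a sequence $X_{i_1}\le X_{i_2}\le\dots\le X_{i_\ell}$ with distinct indices. Put $X_{i_0}=(0,\dots,0)$. The chain is called maximal if for no $k\in\{1,\dots,\ell\}$ there is a point $X_j$, $j\notin\{i_1,\dots,i_\ell\}$, lying strictly between $X_{i_{k-1}}$ and $X_{i_k}$ (no condition is imposed above $X_{i_\ell}$). Let $C_\ell$ be the number of maximal chains of length $\ell$. (i) For $x>0$, $a>\gamma t$ and $b>0$ let $$q(x;a,b)=\max\Bigl\{\rho(a),\ \frac{1+b}{e^b},\ \exp\Bigl(-\frac{e^{-a}}{x^t(1+b)^t}\Bigr)\Bigr\},\qquad \rho(a)=\min_{u\in(0,1)}\frac{\Gamma(1-u)^t}{e^{au}}.$$ Then the minimum that defines $\rho(a)$ is attained, and $q(x;a,b)<1$. For every $x>0$ the minimum $q(x)=\min_{a>\gamma t,\,b>0}q(x;a,b)$ is attained at a unique point $(a(x),b(x))$, it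 satisfies $q(x)<1$, and $$\rho(a(x))=\frac{1+b(x)}{e^{b(x)}}=\exp\Bigl(-\frac{e^{-a(x)}}{x^t(1+b(x))^t}\Bigr).$$ (ii) The set $\{x\in[e^{-\gamma},e]:(e/x)^tq(x)<1\}$ is non-empty, and its infimum $\bar x$ satisfies $\bar x<e$. There is a constant $c>0$ depending only on $t$ such that for every $\varepsilon>0$ there is a constant $K$ depending only on $t$ and $\varepsilon$ with the following property: for all $n$ and all integers $\ell\ge(\bar x+\varepsilon)n^{1/t}$, $$\mathbb E[C_\ell]\le K\exp(-c\,\varepsilon\,n^{1/t}),$$ and the length of the longest chain is less than $(\bar x+\varepsilon)n^{1/t}$ with probability at least $1-K\exp(-c\,\varepsilon\,n^{1/t})$. -/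

import Mathlib

open MeasureTheory Set

namespace RandomChains

noncomputable section

/-! ### Chains in a finite family of points of `ℝ^t` with the coordinatewise order -/

/-- The sequence of distinct indices `s 0, s 1, …, s (ℓ - 1)` is a chain of length `ℓ`:
`X (s 0) ≤ X (s 1) ≤ … ≤ X (s (ℓ - 1))` coordinatewise. -/
def IsChainSeq {n t ℓ : ℕ} (X : Fin n → Fin t → ℝ) (s : Fin ℓ ↪ Fin n) : Prop :=
  ∀ i j : Fin ℓ, i ≤ j → X (s i) ≤ X (s j)

/-- The lower endpoint of the `k`-th interval of the chain: the origin for the first interval, and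
the preceding point of the chain for every other one. The upper endpoint is `X (s k)`. -/
def lowerEnd {n t ℓ : ℕ} (X : Fin n → Fin t → ℝ) (s : Fin ℓ ↪ Fin n) (k : Fin ℓ) : Fin t → ℝ :=
  if (k : ℕ) = 0 then 0 else X (s ⟨(k : ℕ) - 1, lt_of_le_of_lt (Nat.sub_le _ _) k.isLt⟩)

/-- A chain is maximal if none of its `ℓ` intervals contains a point outside of the chain that is
strictly between the endpoints of the interval. The interval from the last point of the chain to
`(1, …, 1)` is not one of them. -/
def IsMaximalChainSeq {n t ℓ : ℕ} (X : Fin n → Fin t → ℝ) (s : Fin ℓ ↪ Fin n) : Prop :=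
  IsChainSeq X s ∧
    ∀ k : Fin ℓ, ∀ j : Fin n, j ∉ range s → ¬ (lowerEnd X s k < X j ∧ X j < X (s k))

/-- `C_ℓ`, the number of maximal chains of length `ℓ`. -/
def numMaximalChains {n t : ℕ} (ℓ : ℕ) (X : Fin n → Fin t → ℝ) : ℕ :=
  Set.ncard {s : Fin ℓ ↪ Fin n | IsMaximalChainSeq X s}

/-- The length of a longest chain (lengths of chains are bounded by `n`, and `0` is one). -/
def longestChain {n t : ℕ} (X : Fin n → Fin t → ℝ) : ℕ :=
  sSup {ℓ : ℕ | ∃ s : Fin ℓ ↪ Fin n, IsChainSeq X s}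

/-- The law of `n` independent uniformly random points of the cube `[0,1]^t`: all `n * t`
coordinates are independent and uniform on `[0,1]`. -/
def pointsLaw (n t : ℕ) : Measure (Fin n → Fin t → ℝ) :=
  Measure.pi fun _ => Measure.pi fun _ => (volume : Measure ℝ).restrict (Icc (0 : ℝ) 1)

/-! ### The constants -/

/-- The values `Γ(1 - u)^t / e^{a u}` for `u ∈ (0,1)`. -/
def rhoValues (t : ℕ) (a : ℝ) : Set ℝ :=
  (fun u : ℝ => Real.Gamma (1 - u) ^ t / Real.exp (a * u)) '' Ioo (0 : ℝ) 1

/-- `ρ(a)`, the minimum of `Γ(1 - u)^t / e^{a u}` over `u ∈ (0,1)`. -/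
def rho (t : ℕ) (a : ℝ) : ℝ := sInf (rhoValues t a)

/-- `(1 + b) / e^b`. -/
def beta (b : ℝ) : ℝ := (1 + b) / Real.exp b

/-- `exp (- e^{-a} / (x^t (1 + b)^t))`. -/
def tau (t : ℕ) (x a b : ℝ) : ℝ := Real.exp (-(Real.exp (-a) / (x ^ t * (1 + b) ^ t)))

/-- `q(x; a, b)`, the largest of the three quantities. -/
def qMax (t : ℕ) (x a b : ℝ) : ℝ := max (rho t a) (max (beta b) (tau t x a b))

/-- The pairs `(a, b)` with `a > γ t` and `b > 0`. -/
def domainAB (t : ℕ) : Set (ℝ × ℝ) :=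
  {p | Real.eulerMascheroniConstant * t < p.1 ∧ 0 < p.2}

/-- `q(x)`, the minimum of `q(x; a, b)` over `a > γ t` and `b > 0`. -/
def qMin (t : ℕ) (x : ℝ) : ℝ := sInf ((fun p : ℝ × ℝ => qMax t x p.1 p.2) '' domainAB t)

/-- The set of all `x ∈ [e^{-γ}, e]` with `(e / x)^t q(x) < 1`. -/
def goodX (t : ℕ) : Set ℝ :=
  {x | x ∈ Icc (Real.exp (-Real.eulerMascheroniConstant)) (Real.exp 1) ∧
    (Real.exp 1 / x) ^ t * qMin t x < 1}

/-- The constant `x̄`. -/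
def xBar (t : ℕ) : ℝ := sInf (goodX t)

end

end RandomChains

open RandomChains

/-! Part (i): `rho` decreases strictly in `a`, `beta` decreases strictly in `b`, and `tau` increases
strictly in both. Moving away from a point where the three agree therefore raises one of them, so
such a point is the unique minimizer (`qMax_lt_of_balanced`); it exists by the intermediate value
theorem (`exists_balanced`).

Part (ii) is a first moment bound. Given the points of a chain, maximality makes the other `n - ℓ`
points avoid the disjoint boxes spanned by consecutive points. With `V` their total volume this has
probability at most `e^{-(n-ℓ)V}`, so `E[C_ℓ]` is at most `n^ℓ` times the integral of `e^{-(n-ℓ)V}`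
over chains (`pointsLaw_isMaximalChainSeq_le`).

For that integral (`lintegral_chains_le`), an exponential tilt replaces the cube by all nonnegative
increments, which become independent. If `V ≥ ℓ e^{-A}`, the exponential is small. Otherwise, by
AM-GM, the product of all increments is at most `e^{-Aℓ}`, which Markov's inequality for its power
`-u` makes unlikely; this produces the factors `Γ(1-u)^t`.

Let `N = n^{1/t}` and `ℓ = λ x N`. For the right `A`, the two cases contribute per step at most
`(e/x)^t λ^{-(1-u)t}` times the function minimized by `rho`, and `(e/x)^t λ^{-t}` times `tau`, up to
a factor `e^{Dℓ²/n}` in total, where `tau = e^{-D}` (`pow_mul_chainBound_le`). At `x = x̄` one has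
`(e/x)^t q(x) ≤ 1`, so the powers of `λ` give the decay. A longest chain is maximal, so a union
bound over lengths finishes the proof. -/

namespace RandomChains

open Filter Topology

local notation "γ" => Real.eulerMascheroniConstant

/-! ### The Gamma function and the minimum `ρ(a)`. -/

/-- The tangent of `log Γ` at `1`. -/
lemma exp_le_Gamma {s : ℝ} (hs : 0 < s) : Real.exp (γ * (1 - s)) ≤ Real.Gamma s := by
  have hd : HasDerivAt (Real.log ∘ Real.Gamma) (-γ) 1 := by
    have h := Real.hasDerivAt_Gamma_one.log (by simp)
    simpa [Function.comp_def] using h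
  have hG := Real.Gamma_pos_of_pos hs
  rw [← Real.le_log_iff_exp_le hG]
  have h1 : (1 : ℝ) ∈ Ioi (0 : ℝ) := by simp
  rcases lt_trichotomy s 1 with h | h | h
  · have := Real.convexOn_log_Gamma.slope_le_of_hasDerivAt hs h1 h hd
    rw [slope_def_field, div_le_iff₀ (by linarith)] at this
    simp at this
    linarith
  · simp [h]
  · have := Real.convexOn_log_Gamma.le_slope_of_hasDerivAt h1 hs h hd
    rw [slope_def_field, le_div_iff₀ (by linarith)] at this
    simp at this
    linarith

/-- The function minimized by `rho`. -/
noncomputable def chernoff (t : ℕ) (a u : ℝ) : ℝ := Real.Gamma (1 - u) ^ t / Real.exp (a * u)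

variable {t : ℕ}

lemma chernoff_pos {a u : ℝ} (hu : u < 1) : 0 < chernoff t a u :=
  div_pos (pow_pos (Real.Gamma_pos_of_pos (by linarith)) _) (Real.exp_pos _)

lemma chernoff_shift (a a' u : ℝ) :
    chernoff t a' u = Real.exp ((a - a') * u) * chernoff t a u := by
  unfold chernoff
  have : Real.exp (a * u) = Real.exp ((a - a') * u) * Real.exp (a' * u) := by
    rw [← Real.exp_add]; ring_nf
  rw [this]
  field_simp

lemma exp_le_chernoff {a u : ℝ} (hu : u < 1) :
    Real.exp ((γ * t - a) * u) ≤ chernoff t a u := by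
  have h := exp_le_Gamma (s := 1 - u) (by linarith)
  have h2 := pow_le_pow_left₀ (Real.exp_pos _).le h t
  rw [chernoff, le_div_iff₀ (Real.exp_pos _), ← Real.exp_add]
  refine le_trans (le_of_eq ?_) h2
  rw [← Real.exp_nat_mul]
  ring_nf

lemma rhoValues_nonempty (a : ℝ) : (rhoValues t a).Nonempty :=
  ⟨_, 1 / 2, by norm_num, rfl⟩

lemma le_rho {a c : ℝ} (h : ∀ u ∈ Ioo (0 : ℝ) 1, c ≤ chernoff t a u) : c ≤ rho t a := by
  refine le_csInf (rhoValues_nonempty a) ?_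
  rintro _ ⟨u, hu, rfl⟩
  exact h u hu

lemma rho_le {a u : ℝ} (hu : u ∈ Ioo (0 : ℝ) 1) : rho t a ≤ chernoff t a u := by
  refine csInf_le ⟨0, ?_⟩ ⟨u, hu, rfl⟩
  rintro _ ⟨v, hv, rfl⟩
  exact (chernoff_pos hv.2).le

/-- Together with `rho_lt_one` this makes `γ t` the exact threshold for `ρ(a) < 1`; it keeps the
solution of the balance equations inside the domain. -/
lemma one_le_rho {a : ℝ} (ha : a ≤ γ * t) : 1 ≤ rho t a :=
  le_rho fun u hu => (Real.one_le_exp (mul_nonneg (by linarith) hu.1.le)).trans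
    (exp_le_chernoff hu.2)

lemma rho_antitone : Antitone (rho t) := by
  intro a' a h
  refine le_rho fun u hu => (rho_le hu).trans ?_
  rw [chernoff_shift a a']
  exact le_mul_of_one_le_left (chernoff_pos hu.2).le
    (Real.one_le_exp (mul_nonneg (by linarith) hu.1.le))

/-- Since `u < 1`, a shift of `a` changes each value by at most the exponential of the shift. With
monotonicity this gives continuity of `rho` without control of the minimizers. -/
lemma rho_le_exp_mul {a' a : ℝ} (h : a' ≤ a) : rho t a' ≤ Real.exp (a - a') * rho t a := by
  have : Real.exp (a' - a) * rho t a' ≤ rho t a := by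
    refine le_rho fun u hu => ?_
    have h1 := rho_le (t := t) (a := a') hu
    rw [chernoff_shift a' a]
    refine mul_le_mul (Real.exp_le_exp.2 ?_) h1 ?_ (Real.exp_pos _).le
    · nlinarith [hu.1, hu.2]
    · exact le_rho fun u hu => (chernoff_pos hu.2).le
  have h2 : Real.exp (a - a') * Real.exp (a' - a) = 1 := by
    rw [← Real.exp_add]; simp
  calc rho t a' = Real.exp (a - a') * (Real.exp (a' - a) * rho t a') := by
        rw [← mul_assoc, h2, one_mul]
    _ ≤ _ := by gcongr

lemma continuous_rho : Continuous (rho t) := by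
  rw [continuous_iff_continuousAt]
  intro a
  have hpos : 0 ≤ rho t a := le_rho fun u hu => (chernoff_pos hu.2).le
  have h1 : Tendsto (fun a' => Real.exp (-|a' - a|) * rho t a) (𝓝 a) (𝓝 (rho t a)) := by
    have : Continuous fun a' => Real.exp (-|a' - a|) * rho t a := by fun_prop
    simpa using this.tendsto a
  have h2 : Tendsto (fun a' => Real.exp (|a' - a|) * rho t a) (𝓝 a) (𝓝 (rho t a)) := by
    have : Continuous fun a' => Real.exp (|a' - a|) * rho t a := by fun_prop
    simpa using this.tendsto a
  refine tendsto_of_tendsto_of_tendsto_of_le_of_le h1 h2 (fun a' => ?_) (fun a' => ?_)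
  · rcases le_total a' a with h | h
    · refine le_trans ?_ (rho_antitone h)
      exact mul_le_of_le_one_left hpos (Real.exp_le_one_iff.2 (by simp))
    · have := rho_le_exp_mul (t := t) h
      calc Real.exp (-|a' - a|) * rho t a
          ≤ Real.exp (-|a' - a|) * (Real.exp (a' - a) * rho t a') := by gcongr
        _ = rho t a' := by
          rw [abs_of_nonneg (by linarith), ← mul_assoc, ← Real.exp_add]; simp
  · rcases le_total a' a with h | h
    · rw [abs_of_nonpos (by linarith), neg_sub]
      exact rho_le_exp_mul h
    · refine (rho_antitone h).trans ?_
      exact le_mul_of_one_le_left hpos (Real.one_le_exp (abs_nonneg _))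

/-- At `u = 0` the function has value `1` and derivative `γ t - a < 0`. -/
lemma exists_chernoff_lt_one {a : ℝ} (ha : γ * t < a) :
    ∃ u ∈ Ioo (0 : ℝ) 1, chernoff t a u < 1 := by
  have hG : HasDerivAt (fun u : ℝ => Real.Gamma (1 - u)) γ 0 := by
    have h0 : HasDerivAt Real.Gamma (-γ) (1 - 0) := by simpa using Real.hasDerivAt_Gamma_one
    have := h0.comp (0 : ℝ) ((hasDerivAt_id (0 : ℝ)).const_sub 1)
    simpa [Function.comp_def] using this
  have hE : HasDerivAt (fun u : ℝ => Real.exp (a * u)) a 0 := by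
    have := ((hasDerivAt_id (0 : ℝ)).const_mul a).exp
    simpa using this
  have hd : HasDerivAt (chernoff t a) (γ * t - a) 0 := by
    have := (hG.fun_pow t).fun_div hE (Real.exp_pos _).ne'
    simp only [sub_zero, Real.Gamma_one, one_pow, mul_one, mul_zero, Real.exp_zero, div_one,
      one_mul] at this
    exact this.congr_deriv (by ring)
  have hlt := hd.hasDerivWithinAt (s := Ioi 0)
  rw [hasDerivWithinAt_iff_tendsto_slope' (by simp)] at hlt
  have hev := hlt.eventually (gt_mem_nhds (show γ * t - a < 0 by linarith))
  have h1 : ∀ᶠ u : ℝ in 𝓝[>] 0, u ∈ Ioo (0 : ℝ) 1 := Ioo_mem_nhdsGT one_pos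
  obtain ⟨u, hu, hu1⟩ := (hev.and h1).exists
  refine ⟨u, hu1, ?_⟩
  rw [slope_def_field, sub_zero, div_lt_iff₀ hu1.1] at hu
  have : chernoff t a 0 = 1 := by simp [chernoff]
  linarith

/-- The pole of `Γ` at `0` keeps the values near `u = 1` above `1`, so compactness applies to the
rest. The endpoint `u = 0` has value `1` and is not the minimizer, because smaller values occur. -/
lemma exists_isMin_chernoff (ht : t ≠ 0) {a : ℝ} (ha : γ * t < a) :
    ∃ u ∈ Ioo (0 : ℝ) 1, rho t a = chernoff t a u ∧ chernoff t a u < 1 := by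
  obtain ⟨u₁, hu₁, h₁⟩ := exists_chernoff_lt_one ha
  have hγ := Real.one_half_lt_eulerMascheroniConstant
  have hγ' := Real.eulerMascheroniConstant_lt_two_thirds
  have ha0 : 0 < a := lt_of_le_of_lt (by positivity) ha
  -- Since `(1-u) Γ(1-u) = Γ(2-u) ≥ e^{-1}`, the condition `1 - u ≤ e^{-1-a}` forces `Γ(1-u) ≥ e^a`.
  set m : ℝ := 1 - Real.exp (-1 - a) with hm
  have hm1 : m < 1 := by have := Real.exp_pos (-1 - a); linarith
  have hm0 : 0 ≤ m := by
    have := Real.exp_le_one_iff.2 (show -1 - a ≤ 0 by linarith); linarith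
  have hbig : ∀ u ∈ Ioo (0 : ℝ) 1, m ≤ u → 1 ≤ chernoff t a u := by
    intro u hu hmu
    have hs : 0 < 1 - u := by linarith [hu.2]
    have h := exp_le_Gamma (s := 1 - u + 1) (by linarith)
    rw [Real.Gamma_add_one hs.ne'] at h
    have h2 : Real.exp (-1) ≤ Real.exp (γ * (1 - (1 - u + 1))) :=
      Real.exp_le_exp.2 (by nlinarith [hu.1])
    have h3 : Real.exp a ≤ Real.Gamma (1 - u) := by
      have h4 : (1 - u) * Real.exp a ≤ (1 - u) * Real.Gamma (1 - u) := by
        calc (1 - u) * Real.exp a ≤ Real.exp (-1 - a) * Real.exp a := by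
              gcongr; linarith
          _ = Real.exp (-1) := by rw [← Real.exp_add]; ring_nf
          _ ≤ _ := h2.trans h
      exact le_of_mul_le_mul_left h4 hs
    have h5 : Real.exp a ≤ Real.Gamma (1 - u) ^ t :=
      h3.trans (le_self_pow₀ ((Real.one_le_exp ha0.le).trans h3) ht)
    rw [chernoff, one_le_div (Real.exp_pos _)]
    refine le_trans (Real.exp_le_exp.2 ?_) h5
    nlinarith [hu.2]
  have hcont : ContinuousOn (chernoff t a) (Icc 0 m) := by
    intro u hu
    have hG : ContinuousAt (fun u : ℝ => Real.Gamma (1 - u)) u := by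
      have hpos : 0 < 1 - u := by linarith [hu.2]
      refine (Real.differentiableAt_Gamma fun k => ?_).continuousAt.comp
        (f := fun u : ℝ => 1 - u) (by fun_prop)
      have : (0 : ℝ) ≤ k := by positivity
      linarith
    refine ContinuousAt.continuousWithinAt ?_
    exact (hG.pow t).div (by fun_prop) (Real.exp_pos _).ne'
  obtain ⟨u₀, hu₀, hmin⟩ := isCompact_Icc.exists_isMinOn ⟨0, by simp [hm0]⟩ hcont
  have hu₁m : u₁ ∈ Icc 0 m := ⟨hu₁.1.le, by
    by_contra hc
    exact absurd h₁ (not_lt.2 (hbig u₁ hu₁ (by linarith)))⟩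
  have hlt : chernoff t a u₀ < 1 := lt_of_le_of_lt (hmin hu₁m) h₁
  have hu₀0 : 0 < u₀ := by
    rcases hu₀.1.lt_or_eq with h | h
    · exact h
    · rw [← h] at hlt; simp [chernoff] at hlt
  have hu₀' : u₀ ∈ Ioo (0 : ℝ) 1 := ⟨hu₀0, lt_of_le_of_lt hu₀.2 hm1⟩
  refine ⟨u₀, hu₀', le_antisymm (rho_le hu₀') (le_rho fun u hu => ?_), hlt⟩
  rcases le_total u m with h | h
  · exact hmin (show u ∈ Icc 0 m from ⟨hu.1.le, h⟩)
  · exact hlt.le.trans (hbig u hu h)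

lemma isLeast_rho (ht : t ≠ 0) {a : ℝ} (ha : γ * t < a) : IsLeast (rhoValues t a) (rho t a) := by
  obtain ⟨u, hu, h, -⟩ := exists_isMin_chernoff ht ha
  refine ⟨h ▸ ⟨u, hu, rfl⟩, ?_⟩
  rintro _ ⟨v, hv, rfl⟩
  exact rho_le hv

lemma rho_lt_one (ht : t ≠ 0) {a : ℝ} (ha : γ * t < a) : rho t a < 1 := by
  obtain ⟨u, hu, h, h1⟩ := exists_isMin_chernoff ht ha
  exact h ▸ h1

lemma rho_strictAnti (ht : t ≠ 0) {a' a : ℝ} (ha : γ * t < a') (h : a' < a) :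
    rho t a < rho t a' := by
  obtain ⟨u, hu, h1, -⟩ := exists_isMin_chernoff ht ha
  rw [h1]
  refine (rho_le hu).trans_lt ?_
  rw [chernoff_shift a a']
  exact lt_mul_of_one_lt_left (chernoff_pos hu.2)
    (Real.one_lt_exp_iff.2 (mul_pos (by linarith) hu.1))

/-! ### Balancing the three quantities in `q(x; a, b)`. -/

lemma beta_strictAnti {b b' : ℝ} (hb : 0 ≤ b) (h : b < b') : beta b' < beta b := by
  unfold beta
  rw [div_lt_div_iff₀ (Real.exp_pos _) (Real.exp_pos _)]
  have h1 : Real.exp b' = Real.exp (b' - b) * Real.exp b := by rw [← Real.exp_add]; ring_nf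
  have h2 := Real.add_one_lt_exp (show b' - b ≠ 0 by linarith)
  rw [h1, ← mul_assoc]
  refine mul_lt_mul_of_pos_right ?_ (Real.exp_pos _)
  nlinarith

lemma beta_lt_one {b : ℝ} (hb : 0 < b) : beta b < 1 := by
  have := beta_strictAnti le_rfl hb
  simpa [beta] using this

lemma tau_lt_one {x a b : ℝ} (hx : 0 < x) (hb : 0 < b) : tau t x a b < 1 := by
  unfold tau
  rw [Real.exp_lt_one_iff, neg_lt_zero]
  positivity

lemma tau_lt {x a b a' b' : ℝ} (hx : 0 < x) (hb : 0 < b) (ht : t ≠ 0) (ha : a ≤ a')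
    (hbb : b ≤ b') (hne : a ≠ a' ∨ b ≠ b') : tau t x a b < tau t x a' b' := by
  unfold tau
  rw [Real.exp_lt_exp, neg_lt_neg_iff]
  have hb' : 0 < b' := hb.trans_le hbb
  rcases hne with h | h
  · refine div_lt_div₀ (Real.exp_lt_exp.2 (neg_lt_neg (lt_of_le_of_ne ha h))) ?_
      (Real.exp_pos _).le (by positivity)
    gcongr
  · have := lt_of_le_of_ne hbb h
    refine div_lt_div₀' (Real.exp_le_exp.2 (neg_le_neg ha)) ?_ (Real.exp_pos _) (by positivity)
    gcongr

lemma tau_mono {x x' a b : ℝ} (hx : 0 < x) (hb : 0 < b) (h : x ≤ x') :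
    tau t x a b ≤ tau t x' a b := by
  unfold tau
  gcongr

lemma qMax_lt_one (ht : t ≠ 0) {x : ℝ} (hx : 0 < x) {p : ℝ × ℝ} (hp : p ∈ domainAB t) :
    qMax t x p.1 p.2 < 1 :=
  max_lt (rho_lt_one ht hp.1) (max_lt (beta_lt_one hp.2) (tau_lt_one hx hp.2))

/-- For each `b` the equation `tau = beta` determines `a`; the remaining equation
`rho = beta` then has a solution by the intermediate value theorem. -/
lemma exists_balanced {x : ℝ} (hx : 0 < x) :
    ∃ p ∈ domainAB t, rho t p.1 = beta p.2 ∧ beta p.2 = tau t x p.1 p.2 := by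
  -- As `beta b = exp (-(b - log (1 + b)))`, the equation `tau = beta` reads `e^{-a} = h b`.
  set h : ℝ → ℝ := fun b => x ^ t * (1 + b) ^ t * (b - Real.log (1 + b)) with hh
  have hpos : ∀ b, 0 < b → 0 < h b := by
    intro b hb
    have := Real.log_lt_sub_one_of_pos (show 0 < 1 + b by linarith) (by linarith)
    have : 0 < b - Real.log (1 + b) := by linarith
    positivity
  have hcont : ContinuousOn h (Ici 0) := by
    have : ContinuousOn (fun b : ℝ => Real.log (1 + b)) (Ici 0) := by
      refine ContinuousOn.log (by fun_prop) fun b hb => ?_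
      have : (0 : ℝ) ≤ b := hb
      linarith
    fun_prop
  have htau : ∀ b, 0 < b → beta b = tau t x (-Real.log (h b)) b := by
    intro b hb
    unfold tau beta
    rw [neg_neg, Real.exp_log (hpos b hb), hh]
    have h1 : x ^ t * (1 + b) ^ t * (b - Real.log (1 + b)) / (x ^ t * (1 + b) ^ t)
        = b - Real.log (1 + b) := by
      have : x ^ t * (1 + b) ^ t ≠ 0 := by positivity
      field_simp
    simp only [h1]
    rw [neg_sub, Real.exp_sub, Real.exp_log (by linarith)]
  -- a small `b`, where `rho` is smaller than `beta`
  obtain ⟨b₁, hb₁, hlt₁⟩ : ∃ b, 0 < b ∧ rho t (-Real.log (h b)) < beta b := by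
    have hlim : Tendsto h (𝓝[>] 0) (𝓝[>] 0) := by
      refine tendsto_nhdsWithin_iff.2 ⟨?_, ?_⟩
      · have := (hcont 0 (by simp)).tendsto
        simp only [hh, add_zero, Real.log_one, sub_zero, mul_zero] at this
        exact this.mono_left (nhdsWithin_mono _ Ioi_subset_Ici_self)
      · filter_upwards [self_mem_nhdsWithin] with b hb using hpos b hb
    have hA : Tendsto (fun b => -Real.log (h b)) (𝓝[>] 0) atTop :=
      tendsto_neg_atBot_atTop.comp (Real.tendsto_log_nhdsGT_zero.comp hlim)
    have hc : Tendsto (fun a : ℝ => chernoff t a (1 / 2)) atTop (𝓝 0) := by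
      unfold chernoff
      refine Tendsto.const_div_atTop (Real.tendsto_exp_atTop.comp ?_) _
      exact tendsto_id.atTop_mul_const (by norm_num)
    have hβ : Tendsto beta (𝓝[>] 0) (𝓝 1) := by
      have : Continuous beta := by
        unfold beta
        exact (by fun_prop : Continuous fun b : ℝ => 1 + b).div₀ Real.continuous_exp
          fun _ => (Real.exp_pos _).ne'
      have := this.tendsto 0
      simp only [beta, add_zero, Real.exp_zero, div_one] at this
      exact this.mono_left nhdsWithin_le_nhds
    have e1 := (hc.comp hA).eventually (gt_mem_nhds (show (0 : ℝ) < 1 / 2 by norm_num))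
    have e2 := hβ.eventually (lt_mem_nhds (show (1 / 2 : ℝ) < 1 by norm_num))
    have e3 : ∀ᶠ b : ℝ in 𝓝[>] 0, 0 < b := self_mem_nhdsWithin
    obtain ⟨b, h1, h2, h3⟩ := (e1.and (e2.and e3)).exists
    exact ⟨b, h3, ((rho_le (by norm_num)).trans_lt h1).trans h2⟩
  -- a large `b`, where `rho` exceeds `1`
  obtain ⟨b₂, hb₂, hle₂⟩ : ∃ b, b₁ ≤ b ∧ -Real.log (h b) ≤ γ * t := by
    have hA : Tendsto h atTop atTop := by
      have hx : 0 < x ^ t := by positivity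
      refine tendsto_atTop_mono' atTop (f₁ := fun b => x ^ t * (b / 2 - 1 / 2)) ?_ ?_
      · filter_upwards [eventually_ge_atTop 1] with b hb
        have h2 : 1 / 2 * (b - 1) ≤ b - Real.log (1 + b) := by
          have := Real.log_le_sub_one_of_pos (show 0 < (1 + b) / 2 by linarith)
          rw [Real.log_div (by linarith) (by norm_num)] at this
          have := Real.log_two_lt_d9
          linarith
        have h3 : 1 ≤ (1 + b) ^ t := one_le_pow₀ (by linarith)
        calc x ^ t * (b / 2 - 1 / 2) = x ^ t * 1 * (1 / 2 * (b - 1)) := by ring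
          _ ≤ x ^ t * (1 + b) ^ t * (b - Real.log (1 + b)) :=
            mul_le_mul (by gcongr) h2 (by nlinarith) (by positivity)
      · refine Tendsto.const_mul_atTop hx ?_
        exact tendsto_atTop_add_const_right _ _ (tendsto_id.atTop_div_const (by norm_num))
    have := (tendsto_neg_atTop_atBot.comp (Real.tendsto_log_atTop.comp hA)).eventually
      (eventually_le_atBot (γ * t))
    obtain ⟨b, h1, h2⟩ := (this.and (eventually_ge_atTop b₁)).exists
    exact ⟨b, h2, h1⟩
  have hcF : ContinuousOn (fun b => rho t (-Real.log (h b)) - beta b) (Icc b₁ b₂) := by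
    have hlog : ContinuousOn (fun b => Real.log (h b)) (Icc b₁ b₂) := by
      refine ContinuousOn.log (hcont.mono ?_) fun b hb => (hpos b (hb₁.trans_le hb.1)).ne'
      exact fun b hb => hb₁.le.trans hb.1
    have hβ : Continuous beta := by
      unfold beta
      exact (by fun_prop : Continuous fun b : ℝ => 1 + b).div₀ Real.continuous_exp
        fun _ => (Real.exp_pos _).ne'
    exact (continuous_rho.comp_continuousOn hlog.neg).sub hβ.continuousOn
  have h0 : (0 : ℝ) ∈ Icc (rho t (-Real.log (h b₁)) - beta b₁) (rho t (-Real.log (h b₂)) - beta b₂) :=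
    ⟨by linarith, by
      have := one_le_rho hle₂
      have := beta_lt_one (hb₁.trans_le hb₂)
      linarith⟩
  obtain ⟨b, hb, hb0⟩ := intermediate_value_Icc hb₂ hcF h0
  have hbpos := hb₁.trans_le hb.1
  have heq : rho t (-Real.log (h b)) = beta b := sub_eq_zero.1 hb0
  refine ⟨(-Real.log (h b), b), ⟨?_, hbpos⟩, heq, htau b hbpos⟩
  by_contra hc
  have := one_le_rho (not_lt.1 hc)
  have := beta_lt_one hbpos
  simp only at *
  linarith

/-- A smaller `a` raises `rho`, a smaller `b` raises `beta`, and otherwise `tau` goes up. -/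
lemma qMax_lt_of_balanced (ht : t ≠ 0) {x : ℝ} (hx : 0 < x) {p p' : ℝ × ℝ} (hp : p ∈ domainAB t)
    (h1 : rho t p.1 = beta p.2) (h2 : beta p.2 = tau t x p.1 p.2) (hp' : p' ∈ domainAB t)
    (hne : p' ≠ p) : qMax t x p.1 p.2 < qMax t x p'.1 p'.2 := by
  have hq : qMax t x p.1 p.2 = beta p.2 := by simp [qMax, h1, ← h2]
  rw [hq]
  unfold qMax
  rw [lt_max_iff, lt_max_iff]
  by_cases ha : p'.1 < p.1
  · left; rw [← h1]; exact rho_strictAnti ht hp'.1 ha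
  by_cases hb : p'.2 < p.2
  · right; left; exact beta_strictAnti hp'.2.le hb
  right; right
  rw [h2]
  refine tau_lt hx hp.2 ht (not_lt.1 ha) (not_lt.1 hb) ?_
  by_contra hc
  push Not at hc
  exact hne (Prod.ext hc.1.symm hc.2.symm)

lemma qMin_le {x : ℝ} {p : ℝ × ℝ} (hp : p ∈ domainAB t) :
    qMin t x ≤ qMax t x p.1 p.2 := by
  refine csInf_le ⟨0, ?_⟩ ⟨p, hp, rfl⟩
  rintro _ ⟨p', hp', rfl⟩
  exact (Real.exp_pos _).le.trans ((le_max_right _ _).trans (le_max_right _ _))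

lemma qMax_eq_qMin_of_balanced (ht : t ≠ 0) {x : ℝ} (hx : 0 < x) {p : ℝ × ℝ} (hp : p ∈ domainAB t)
    (h1 : rho t p.1 = beta p.2) (h2 : beta p.2 = tau t x p.1 p.2) :
    qMax t x p.1 p.2 = qMin t x := by
  refine le_antisymm (le_csInf ⟨_, p, hp, rfl⟩ ?_) (qMin_le hp)
  rintro _ ⟨p', hp', rfl⟩
  by_cases hne : p' = p
  · rw [hne]
  · exact (qMax_lt_of_balanced ht hx hp h1 h2 hp' hne).le

/-! ### The function `q` and the constant `x̄`. -/

lemma qMin_lt_one (ht : t ≠ 0) {x : ℝ} (hx : 0 < x) : qMin t x < 1 := by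
  obtain ⟨p, hp, -⟩ := exists_balanced (t := t) hx
  exact (qMin_le hp).trans_lt (qMax_lt_one ht hx hp)

lemma qMin_mono (ht : t ≠ 0) {x x' : ℝ} (hx : 0 < x) (h : x ≤ x') : qMin t x ≤ qMin t x' := by
  obtain ⟨p, hp, h1, h2⟩ := exists_balanced (t := t) (hx.trans_le h)
  rw [← qMax_eq_qMin_of_balanced ht (hx.trans_le h) hp h1 h2]
  refine (qMin_le hp).trans ?_
  exact max_le_max le_rfl (max_le_max le_rfl (tau_mono hx hp.2 h))

lemma exp_one_mem_goodX (ht : t ≠ 0) : Real.exp 1 ∈ goodX t := by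
  have := Real.one_half_lt_eulerMascheroniConstant
  refine ⟨⟨Real.exp_le_exp.2 (by linarith), le_rfl⟩, ?_⟩
  rw [div_self (Real.exp_pos _).ne', one_pow, one_mul]
  exact qMin_lt_one ht (Real.exp_pos _)

lemma bddBelow_goodX : BddBelow (goodX t) := ⟨_, fun _ hx => hx.1.1⟩

/-- By monotonicity `q(x) ≤ q(e) < 1` below `e`, and `(e/x)^t q(e)` stays below `1` just to the left
of `e`. -/
lemma xBar_lt (ht : t ≠ 0) : xBar t < Real.exp 1 := by
  have hγ := Real.one_half_lt_eulerMascheroniConstant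
  have hcont : ContinuousAt (fun x => (Real.exp 1 / x) ^ t * qMin t (Real.exp 1)) (Real.exp 1) :=
    ((continuousAt_const.div continuousAt_id (Real.exp_pos _).ne').pow t).mul continuousAt_const
  have hev : ∀ᶠ x in 𝓝[<] (Real.exp 1), (Real.exp 1 / x) ^ t * qMin t (Real.exp 1) < 1 := by
    refine nhdsWithin_le_nhds (hcont.eventually (gt_mem_nhds ?_))
    simpa using qMin_lt_one ht (Real.exp_pos 1)
  have hI : ∀ᶠ x in 𝓝[<] (Real.exp 1), x ∈ Ioo (Real.exp (-γ)) (Real.exp 1) :=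
    Ioo_mem_nhdsLT (Real.exp_lt_exp.2 (by linarith))
  obtain ⟨x, h1, h2⟩ := (hev.and hI).exists
  have hx : 0 < x := (Real.exp_pos _).trans h2.1
  refine (csInf_le bddBelow_goodX ⟨⟨h2.1.le, h2.2.le⟩, ?_⟩).trans_lt h2.2
  refine lt_of_le_of_lt ?_ h1
  exact mul_le_mul_of_nonneg_left (qMin_mono ht hx h2.2.le) (by positivity)

lemma xBar_pos (ht : t ≠ 0) : 0 < xBar t :=
  (Real.exp_pos _).trans_le (le_csInf ⟨_, exp_one_mem_goodX ht⟩ fun _ hx => hx.1.1)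

/-- The infimum need not be a good point itself, but `q(x̄) ≤ q(x) ≤ (x/e)^t` along good `x` tending
to `x̄`. -/
lemma qMin_xBar_le (ht : t ≠ 0) : qMin t (xBar t) ≤ (xBar t / Real.exp 1) ^ t := by
  have hx0 := xBar_pos (t := t) ht
  have hcont : ContinuousWithinAt (fun x => (x / Real.exp 1) ^ t) (Ioi (xBar t)) (xBar t) :=
    Continuous.continuousWithinAt (by fun_prop)
  refine ge_of_tendsto hcont.tendsto ?_
  filter_upwards [self_mem_nhdsWithin] with y hy
  obtain ⟨x, hx, hxy⟩ := exists_lt_of_csInf_lt ⟨_, exp_one_mem_goodX ht⟩ (show sInf (goodX t) < y from hy)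
  have hxx : xBar t ≤ x := csInf_le bddBelow_goodX hx
  have hxpos := hx0.trans_le hxx
  have h2 := hx.2
  refine (qMin_mono ht hx0 hxx).trans ?_
  have h3 : qMin t x ≤ (x / Real.exp 1) ^ t := by
    have h4 : (x / Real.exp 1) ^ t * (Real.exp 1 / x) ^ t = 1 := by
      rw [← mul_pow, div_mul_div_cancel₀ (Real.exp_pos _).ne', div_self hxpos.ne', one_pow]
    calc qMin t x = (x / Real.exp 1) ^ t * ((Real.exp 1 / x) ^ t * qMin t x) := by
          rw [← mul_assoc, h4, one_mul]
      _ ≤ (x / Real.exp 1) ^ t := mul_le_of_le_one_right (by positivity) h2.le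
  refine h3.trans ?_
  gcongr

/-! ### Integrals over chains in terms of increments. -/

open ENNReal

variable {ℓ n : ℕ}

/-- The predecessors of the terms of a sequence, with base point `p` before the first one. -/
def prev {G : Type*} (p : G) (y : Fin ℓ → G) (k : Fin ℓ) : G :=
  (Fin.cons p y : Fin (ℓ + 1) → G) k.castSucc

lemma prev_cons_zero {G : Type*} (p a : G) (w : Fin ℓ → G) :
    prev p (Fin.cons a w : Fin (ℓ + 1) → G) 0 = p := rfl

lemma prev_cons_succ {G : Type*} (p a : G) (w : Fin ℓ → G) (k : Fin ℓ) :
    prev p (Fin.cons a w : Fin (ℓ + 1) → G) k.succ = prev a w k := rfl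

lemma prev_eq {G : Type*} (p : G) (y : Fin ℓ → G) (k : Fin ℓ) :
    prev p y k = if _h : (k : ℕ) = 0 then p
      else y ⟨(k : ℕ) - 1, lt_of_le_of_lt (Nat.sub_le _ _) k.isLt⟩ := by
  rcases k with ⟨_ | k, hk⟩ <;> rfl

lemma lowerEnd_eq_prev (X : Fin n → Fin t → ℝ) (s : Fin ℓ ↪ Fin n) (k : Fin ℓ) :
    lowerEnd X s k = prev 0 (fun j => X (s j)) k := by
  rw [prev_eq]; rfl

lemma sum_increments {G : Type*} [AddCommGroup G] (p : G) (y : Fin ℓ → G) :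
    ∑ k, (y k - prev p y k) = (Fin.cons p y : Fin (ℓ + 1) → G) (Fin.last ℓ) - p := by
  induction ℓ generalizing p with
  | zero => simp
  | succ m ih =>
    obtain ⟨a, w, rfl⟩ : ∃ a w, y = Fin.cons a w := ⟨y 0, Fin.tail y, (Fin.cons_self_tail y).symm⟩
    rw [Fin.sum_univ_succ]
    simp only [prev_cons_zero, prev_cons_succ, Fin.cons_succ, Fin.cons_zero, ih]
    rw [← Fin.succ_last, Fin.cons_succ]
    abel

lemma measurable_prev {G : Type*} [MeasurableSpace G] (p : G) (k : Fin ℓ) :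
    Measurable fun y : Fin ℓ → G => prev p y k := by
  rcases k with ⟨_ | k, hk⟩
  · exact measurable_const
  · exact measurable_pi_apply (⟨k, by omega⟩ : Fin ℓ)

lemma lintegral_fin_succ {G : Type*} [MeasureSpace G] [SigmaFinite (volume : Measure G)]
    {f : (Fin (ℓ + 1) → G) → ℝ≥0∞} (hf : Measurable f) :
    ∫⁻ y, f y = ∫⁻ a, ∫⁻ w : Fin ℓ → G, f (Fin.cons a w) := by
  have h := (volume_preserving_piFinSuccAbove (fun _ : Fin (ℓ + 1) => G) 0).symm
  rw [← h.lintegral_comp hf, Measure.volume_eq_prod, lintegral_prod]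
  · refine lintegral_congr fun a => lintegral_congr fun w => ?_
    simp [MeasurableEquiv.piFinSuccAbove, Fin.insertNthEquiv]
  · exact (hf.comp (MeasurableEquiv.measurable _)).aemeasurable

lemma lintegral_prod_coords {h : ℝ → ℝ≥0∞} (hh : Measurable h) (m : ℕ) :
    ∫⁻ z : Fin m → ℝ, ∏ i, h (z i) = (∫⁻ x, h x) ^ m := by
  induction m with
  | zero => simp [volume_pi]
  | succ m ih =>
    rw [lintegral_fin_succ (by fun_prop)]
    simp only [Fin.prod_univ_succ, Fin.cons_zero, Fin.cons_succ]
    have : ∀ a, ∫⁻ w : Fin m → ℝ, h a * ∏ i, h (w i) = h a * (∫⁻ x, h x) ^ m := fun a => by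
      rw [lintegral_const_mul _ (by fun_prop), ih]
    simp only [this]
    rw [lintegral_mul_const _ hh, pow_succ']

/-- By translation invariance the integral over all later points does not depend on the first one,
which becomes their base point; hence the induction over all base points `p`. -/
lemma lintegral_prod_increments {g : (Fin t → ℝ) → ℝ≥0∞} (hg : Measurable g) (ℓ : ℕ)
    (p : Fin t → ℝ) :
    ∫⁻ y : Fin ℓ → Fin t → ℝ, ∏ k, g (y k - prev p y k) = (∫⁻ z, g z) ^ ℓ := by
  have hm : ∀ (m : ℕ) (q : Fin t → ℝ),
      Measurable fun y : Fin m → Fin t → ℝ => ∏ k, g (y k - prev q y k) := fun m q =>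
    Finset.measurable_fun_prod _ fun k _ => hg.comp ((measurable_pi_apply k).sub (measurable_prev q k))
  induction ℓ generalizing p with
  | zero => simp [volume_pi]
  | succ m ih =>
    rw [lintegral_fin_succ (hm _ _)]
    simp only [Fin.prod_univ_succ, Fin.cons_zero, Fin.cons_succ, prev_cons_zero, prev_cons_succ]
    have : ∀ a, ∫⁻ w : Fin m → Fin t → ℝ, g (a - p) * ∏ k, g (w k - prev a w k)
        = g (a - p) * (∫⁻ z, g z) ^ m := fun a => by
      rw [lintegral_const_mul _ (hm _ _), ih]
    simp only [this]
    rw [lintegral_mul_const _ (show Measurable fun a => g (a - p) from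
        hg.comp (measurable_id.sub_const p)),
      lintegral_sub_right_eq_self g p, pow_succ']

/-- The density `z^{-u} e^{-θ z}` on `[0, ∞)`. -/
noncomputable def gammaWeight (u θ z : ℝ) : ℝ≥0∞ :=
  if 0 ≤ z then ENNReal.ofReal z ^ (-u) * ENNReal.ofReal (Real.exp (-(θ * z))) else 0

lemma measurable_gammaWeight (u θ : ℝ) : Measurable (gammaWeight u θ) := by
  unfold gammaWeight
  refine Measurable.ite measurableSet_Ici ?_ measurable_const
  fun_prop

lemma lintegral_gammaWeight {u θ : ℝ} (hu : u < 1) (hθ : 0 < θ) :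
    ∫⁻ z, gammaWeight u θ z = ENNReal.ofReal ((1 / θ) ^ (1 - u) * Real.Gamma (1 - u)) := by
  have hint := Real.integral_rpow_mul_exp_neg_mul_Ioi (show 0 < 1 - u by linarith) hθ
  have hpos : 0 < (1 / θ) ^ (1 - u) * Real.Gamma (1 - u) :=
    mul_pos (by positivity) (Real.Gamma_pos_of_pos (by linarith))
  rw [← hint, ofReal_integral_eq_lintegral_ofReal]
  · rw [← lintegral_indicator measurableSet_Ioi]
    -- For `u > 0` the weight is infinite at `z = 0`, so the integrands agree only almost
    -- everywhere.
    refine lintegral_congr_ae ?_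
    filter_upwards [Measure.ae_ne volume (0 : ℝ)] with z hz
    unfold gammaWeight
    by_cases h : 0 < z
    · rw [if_pos h.le, indicator_of_mem (by exact h), ENNReal.ofReal_mul (by positivity),
        ENNReal.ofReal_rpow_of_pos h]
      congr 3; ring
    · have : z < 0 := lt_of_le_of_ne (not_lt.1 h) hz
      rw [if_neg (by linarith), indicator_of_notMem (by exact h)]
  · exact Integrable.of_integral_ne_zero (by rw [hint]; exact hpos.ne')
  · refine (ae_restrict_iff' measurableSet_Ioi).2 (ae_of_all _ fun z hz => ?_)
    have : (0 : ℝ) < z := hz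
    simp only [Pi.zero_apply]
    positivity

/-- The total volume of the boxes spanned by consecutive points. -/
def boxVolume (y : Fin ℓ → Fin t → ℝ) : ℝ := ∑ k, ∏ i, (y k i - prev 0 y k i)

/-- Markov's inequality for the product of all increments, after the inequality of arithmetic and
geometric means. -/
lemma exp_neg_sum_le (hℓ : ℓ ≠ 0) {u : ℝ} (hu : 0 < u) (A : ℝ) {M : ℝ} (hM : 0 ≤ M)
    {z : Fin ℓ → Fin t → ℝ} (hz : ∀ k i, 0 ≤ z k i) :
    ENNReal.ofReal (Real.exp (-(M * ∑ k, ∏ i, z k i))) ≤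
      ENNReal.ofReal (Real.exp (-(u * A * ℓ))) * ∏ k, ∏ i, ENNReal.ofReal (z k i) ^ (-u) +
        ENNReal.ofReal (Real.exp (-(M * (ℓ * Real.exp (-A))))) := by
  set V := ∑ k, ∏ i, z k i with hV
  have hw : ∀ k, 0 ≤ ∏ i, z k i := fun k => Finset.prod_nonneg fun i _ => hz k i
  have hV0 : 0 ≤ V := Finset.sum_nonneg fun k _ => hw k
  have hℓ0 : (0 : ℝ) < ℓ := by positivity
  -- A large volume is paid for by the last summand; a small one makes the average box, hence the
  -- geometric mean, smaller than `e^{-A}`.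
  rcases le_or_gt (ℓ * Real.exp (-A)) V with h | h
  · refine le_trans (ENNReal.ofReal_le_ofReal (Real.exp_le_exp.2 ?_)) le_add_self
    exact neg_le_neg (mul_le_mul_of_nonneg_left h hM)
  · refine le_trans ?_ le_self_add
    have hP : ∏ k, ∏ i, z k i ≤ Real.exp (-(A * ℓ)) := by
      have h1 := Real.geom_mean_le_arith_mean Finset.univ (fun _ : Fin ℓ => (1 : ℝ))
        (fun k => ∏ i, z k i) (by simp) (by simpa using Nat.pos_of_ne_zero hℓ) (fun k _ => hw k)
      simp only [Real.rpow_one, Finset.sum_const, Finset.card_univ, Fintype.card_fin, nsmul_eq_mul,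
        mul_one, one_mul] at h1
      rw [← hV] at h1
      have hP0 : 0 ≤ ∏ k, ∏ i, z k i := Finset.prod_nonneg fun k _ => hw k
      have h2 : (∏ k, ∏ i, z k i) = ((∏ k, ∏ i, z k i) ^ (ℓ : ℝ)⁻¹) ^ ℓ :=
        (Real.rpow_inv_natCast_pow hP0 hℓ).symm
      rw [h2]
      have h3 : V / ℓ ≤ Real.exp (-A) := by
        rw [div_le_iff₀ hℓ0]; linarith
      calc _ ≤ (Real.exp (-A)) ^ ℓ := pow_le_pow_left₀ (by positivity) (h1.trans h3) _
        _ = _ := by rw [← Real.exp_nat_mul]; ring_nf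
    have h4 : ∏ k, ∏ i, ENNReal.ofReal (z k i) ^ (-u) =
        ENNReal.ofReal (∏ k, ∏ i, z k i) ^ (-u) := by
      rw [ENNReal.ofReal_prod_of_nonneg (fun k _ => hw k),
        ← ENNReal.prod_rpow_of_ne_top (fun k _ => ENNReal.ofReal_ne_top)]
      refine Finset.prod_congr rfl fun k _ => ?_
      rw [ENNReal.ofReal_prod_of_nonneg (fun i _ => hz k i),
        ← ENNReal.prod_rpow_of_ne_top (fun k _ => ENNReal.ofReal_ne_top)]
    have h5 : ENNReal.ofReal (Real.exp (u * A * ℓ)) ≤ ENNReal.ofReal (∏ k, ∏ i, z k i) ^ (-u) := by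
      have : ENNReal.ofReal (Real.exp (u * A * ℓ)) =
          ENNReal.ofReal (Real.exp (-(A * ℓ))) ^ (-u) := by
        rw [ENNReal.ofReal_rpow_of_pos (Real.exp_pos _), ← Real.exp_mul]
        ring_nf
      rw [this, ENNReal.rpow_neg, ENNReal.rpow_neg, ENNReal.inv_le_inv]
      exact ENNReal.rpow_le_rpow (ENNReal.ofReal_le_ofReal hP) hu.le
    rw [h4]
    calc ENNReal.ofReal (Real.exp (-(M * V))) ≤ ENNReal.ofReal 1 :=
          ENNReal.ofReal_le_ofReal (Real.exp_le_one_iff.2 (by nlinarith))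
      _ = ENNReal.ofReal (Real.exp (-(u * A * ℓ))) * ENNReal.ofReal (Real.exp (u * A * ℓ)) := by
          rw [← ENNReal.ofReal_mul (Real.exp_pos _).le, ← Real.exp_add]; simp
      _ ≤ _ := by gcongr

/-- On chains in the unit cube the exponential tilt is at least `1`. -/
lemma one_le_tilt {θ : ℝ} (hθ : 0 ≤ θ) {y : Fin ℓ → Fin t → ℝ} (h1 : ∀ k i, y k i ≤ 1) :
    1 ≤ ENNReal.ofReal (Real.exp (θ * t)) *
      ∏ k, ∏ i, ENNReal.ofReal (Real.exp (-(θ * (y k i - prev 0 y k i)))) := by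
  have hlast : ∀ i, (Fin.cons 0 y : Fin (ℓ + 1) → Fin t → ℝ) (Fin.last ℓ) i ≤ 1 := by
    intro i
    rcases ℓ with _ | m
    · simp
    · rw [← Fin.succ_last, Fin.cons_succ]; exact h1 _ _
  have hsum : ∑ k, ∑ i, (y k i - prev 0 y k i) ≤ t := by
    rw [Finset.sum_comm]
    calc _ ≤ ∑ i : Fin t, (1 : ℝ) := Finset.sum_le_sum fun i _ => by
          have := congrFun (sum_increments 0 y) i
          rw [Finset.sum_apply] at this
          simp only [Pi.sub_apply, Pi.zero_apply, sub_zero] at this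
          rw [this]; exact hlast i
      _ = t := by simp
  have h2 : ∏ k, ∏ i, ENNReal.ofReal (Real.exp (-(θ * (y k i - prev 0 y k i)))) =
      ENNReal.ofReal (Real.exp (-(θ * ∑ k, ∑ i, (y k i - prev 0 y k i)))) := by
    rw [Finset.mul_sum, ← Finset.sum_neg_distrib, Real.exp_sum,
      ENNReal.ofReal_prod_of_nonneg fun _ _ => (Real.exp_pos _).le]
    refine Finset.prod_congr rfl fun k _ => ?_
    rw [Finset.mul_sum, ← Finset.sum_neg_distrib, Real.exp_sum,
      ENNReal.ofReal_prod_of_nonneg fun _ _ => (Real.exp_pos _).le]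
  rw [h2, ← ENNReal.ofReal_mul (Real.exp_pos _).le, ← Real.exp_add, ENNReal.one_le_ofReal]
  refine Real.one_le_exp ?_
  nlinarith

/-- A bound for the integral of `e^{-M V}` over chains in the unit cube, `V` being the volume of
the boxes spanned by consecutive points. -/
noncomputable def chainBound (t ℓ : ℕ) (u A M : ℝ) : ℝ :=
  Real.exp (ℓ * t) * (Real.exp (-(u * A * ℓ)) *
      ((1 / (ℓ : ℝ)) ^ (1 - u) * Real.Gamma (1 - u)) ^ (t * ℓ) +
    Real.exp (-(M * (ℓ * Real.exp (-A)))) * (1 / (ℓ : ℝ)) ^ (t * ℓ))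

/-- The tilt parameter is `θ = ℓ`, which minimizes `e^{θt} θ^{-tℓ}`. Exponent `u` serves the Markov
term and exponent `0` the large-volume term. -/
lemma lintegral_chains_le (hℓ : ℓ ≠ 0) {u : ℝ} (hu : u ∈ Ioo (0 : ℝ) 1) (A : ℝ) {M : ℝ}
    (hM : 0 ≤ M) {S : Set (Fin ℓ → Fin t → ℝ)} (hS : MeasurableSet S)
    (h0 : ∀ y ∈ S, ∀ k, prev 0 y k ≤ y k) (h1 : ∀ y ∈ S, ∀ k i, y k i ≤ 1) :
    ∫⁻ y in S, ENNReal.ofReal (Real.exp (-(M * boxVolume y))) ≤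
      ENNReal.ofReal (chainBound t ℓ u A M) := by
  have hθ : (0 : ℝ) < ℓ := by positivity
  set g : ℝ → (Fin t → ℝ) → ℝ≥0∞ := fun v z => ∏ i, gammaWeight v ℓ (z i) with hg
  have hgm : ∀ v, Measurable (g v) := fun v =>
    Finset.measurable_fun_prod _ fun i _ => (measurable_gammaWeight v ℓ).comp (measurable_pi_apply i)
  have hgi : ∀ v < 1, ∫⁻ y : Fin ℓ → Fin t → ℝ, ∏ k, g v (y k - prev 0 y k) =
      ENNReal.ofReal (((1 / (ℓ : ℝ)) ^ (1 - v) * Real.Gamma (1 - v)) ^ (t * ℓ)) := by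
    intro v hv
    have hG := Real.Gamma_pos_of_pos (show 0 < 1 - v by linarith)
    rw [lintegral_prod_increments (hgm v), lintegral_prod_coords (measurable_gammaWeight v ℓ),
      lintegral_gammaWeight hv hθ, ← pow_mul, ENNReal.ofReal_pow (by positivity)]
  have hm : ∀ v, Measurable fun y : Fin ℓ → Fin t → ℝ => ∏ k, g v (y k - prev 0 y k) := fun v =>
    Finset.measurable_fun_prod _ fun k _ =>
      (hgm v).comp ((measurable_pi_apply k).sub (measurable_prev 0 k))
  set c₀ := ENNReal.ofReal (Real.exp (ℓ * t))
  set c₁ := ENNReal.ofReal (Real.exp (-(u * A * ℓ)))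
  set c₂ := ENNReal.ofReal (Real.exp (-(M * (ℓ * Real.exp (-A)))))
  have hpt : ∀ y ∈ S, ENNReal.ofReal (Real.exp (-(M * boxVolume y))) ≤
      c₀ * (c₁ * ∏ k, g u (y k - prev 0 y k) + c₂ * ∏ k, g 0 (y k - prev 0 y k)) := by
    intro y hy
    have hz : ∀ k i, 0 ≤ y k i - prev 0 y k i := fun k i => sub_nonneg.2 (h0 y hy k i)
    have e1 := exp_neg_sum_le hℓ hu.1 A hM hz
    have e2 := one_le_tilt hθ.le (h1 y hy)
    set T := ∏ k, ∏ i, ENNReal.ofReal (Real.exp (-((ℓ : ℝ) * (y k i - prev 0 y k i))))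
    have hgv : ∀ v, ∏ k, g v (y k - prev 0 y k) =
        (∏ k, ∏ i, ENNReal.ofReal (y k i - prev 0 y k i) ^ (-v)) * T := by
      intro v
      simp only [hg, T, ← Finset.prod_mul_distrib]
      refine Finset.prod_congr rfl fun k _ => Finset.prod_congr rfl fun i _ => ?_
      rw [gammaWeight, if_pos (by exact hz k i)]
      rfl
    rw [hgv u, hgv 0]
    simp only [neg_zero, ENNReal.rpow_zero, Finset.prod_const_one, one_mul]
    calc ENNReal.ofReal (Real.exp (-(M * boxVolume y)))
        ≤ (c₁ * (∏ k, ∏ i, ENNReal.ofReal (y k i - prev 0 y k i) ^ (-u)) + c₂) * (c₀ * T) :=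
          e1.trans (le_mul_of_one_le_right' e2)
      _ = _ := by ring
  calc ∫⁻ y in S, ENNReal.ofReal (Real.exp (-(M * boxVolume y)))
      ≤ ∫⁻ y in S, c₀ * (c₁ * ∏ k, g u (y k - prev 0 y k) + c₂ * ∏ k, g 0 (y k - prev 0 y k)) :=
        setLIntegral_mono' hS hpt
    _ ≤ ∫⁻ y, c₀ * (c₁ * ∏ k, g u (y k - prev 0 y k) + c₂ * ∏ k, g 0 (y k - prev 0 y k)) :=
        setLIntegral_le_lintegral _ _
    _ = c₀ * (c₁ * ENNReal.ofReal (((1 / (ℓ : ℝ)) ^ (1 - u) * Real.Gamma (1 - u)) ^ (t * ℓ)) +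
          c₂ * ENNReal.ofReal ((1 / (ℓ : ℝ)) ^ (t * ℓ))) := by
        have hadd : Measurable fun y : Fin ℓ → Fin t → ℝ =>
            c₁ * ∏ k, g u (y k - prev 0 y k) + c₂ * ∏ k, g 0 (y k - prev 0 y k) :=
          ((hm u).const_mul c₁).add ((hm 0).const_mul c₂)
        rw [lintegral_const_mul _ hadd, lintegral_add_left ((hm u).const_mul c₁), lintegral_const_mul _ (hm u), lintegral_const_mul _ (hm 0), hgi u hu.2,
          hgi 0 one_pos]
        simp
    _ = _ := by
        have hG := Real.Gamma_pos_of_pos (show 0 < 1 - u by linarith [hu.2])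
        rw [chainBound, ENNReal.ofReal_mul (by positivity), ENNReal.ofReal_add (by positivity)
          (by positivity), ENNReal.ofReal_mul (by positivity), ENNReal.ofReal_mul (by positivity)]

/-! ### The probability that a given sequence is a maximal chain. -/

/-- The law of a uniformly random point of the unit cube. -/
noncomputable def cubeLaw (t : ℕ) : Measure (Fin t → ℝ) :=
  Measure.pi fun _ => (volume : Measure ℝ).restrict (Icc (0 : ℝ) 1)

instance : IsProbabilityMeasure ((volume : Measure ℝ).restrict (Icc (0 : ℝ) 1)) :=
  ⟨by simp⟩

instance : IsProbabilityMeasure (cubeLaw t) := by unfold cubeLaw; infer_instance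

instance : IsProbabilityMeasure (pointsLaw n t) := by unfold pointsLaw; infer_instance

lemma cubeLaw_eq (t : ℕ) : cubeLaw t = volume.restrict (univ.pi fun _ => Icc (0 : ℝ) 1) := by
  rw [volume_pi, Measure.restrict_pi_pi]; rfl

lemma pi_cubeLaw_eq (ℓ t : ℕ) : Measure.pi (fun _ : Fin ℓ => cubeLaw t) =
    volume.restrict (univ.pi fun _ : Fin ℓ => univ.pi fun _ : Fin t => Icc (0 : ℝ) 1) := by
  rw [volume_pi, Measure.restrict_pi_pi]
  simp only [cubeLaw_eq]

lemma measurableSet_le_pi {α : Type*} [MeasurableSpace α] {f g : α → Fin t → ℝ}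
    (hf : Measurable f) (hg : Measurable g) : MeasurableSet {x | f x ≤ g x} := by
  simp only [Pi.le_def, ofPred_forall]
  exact MeasurableSet.iInter fun i => measurableSet_le ((measurable_pi_apply i).comp hf)
    ((measurable_pi_apply i).comp hg)

lemma measurableSet_lt_pi {α : Type*} [MeasurableSpace α] {f g : α → Fin t → ℝ}
    (hf : Measurable f) (hg : Measurable g) : MeasurableSet {x | f x < g x} := by
  simp only [lt_iff_le_not_ge]
  exact (measurableSet_le_pi hf hg).inter (measurableSet_le_pi hg hf).compl

lemma measurable_lowerEnd (s : Fin ℓ ↪ Fin n) (k : Fin ℓ) :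
    Measurable fun X : Fin n → Fin t → ℝ => lowerEnd X s k := by
  unfold lowerEnd
  split_ifs
  · exact measurable_const
  · exact measurable_pi_apply _

lemma measurableSet_isChainSeq (s : Fin ℓ ↪ Fin n) :
    MeasurableSet {X : Fin n → Fin t → ℝ | IsChainSeq X s} := by
  simp only [IsChainSeq, ofPred_forall]
  exact MeasurableSet.iInter fun i => MeasurableSet.iInter fun j => MeasurableSet.iInter fun _ =>
    measurableSet_le_pi (measurable_pi_apply _) (measurable_pi_apply _)

lemma measurableSet_isMaximalChainSeq (s : Fin ℓ ↪ Fin n) :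
    MeasurableSet {X : Fin n → Fin t → ℝ | IsMaximalChainSeq X s} := by
  refine (measurableSet_isChainSeq s).inter ?_
  change MeasurableSet {X : Fin n → Fin t → ℝ | ∀ k : Fin ℓ, ∀ j : Fin n, j ∉ range s →
    ¬ (lowerEnd X s k < X j ∧ X j < X (s k))}
  simp only [ofPred_forall]
  exact MeasurableSet.iInter fun k => MeasurableSet.iInter fun j => MeasurableSet.iInter fun _ =>
    ((measurableSet_lt_pi (measurable_lowerEnd s k) (measurable_pi_apply j)).inter
      (measurableSet_lt_pi (measurable_pi_apply j) (measurable_pi_apply _))).compl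

/-- The open boxes spanned by consecutive points of a chain. -/
def openBox (y : Fin ℓ → Fin t → ℝ) (k : Fin ℓ) : Set (Fin t → ℝ) :=
  univ.pi fun i => Ioo (prev 0 y k i) (y k i)

lemma measurableSet_openBox (y : Fin ℓ → Fin t → ℝ) (k : Fin ℓ) : MeasurableSet (openBox y k) :=
  MeasurableSet.univ_pi fun _ => measurableSet_Ioo

lemma le_prev_of_lt {y : Fin ℓ → Fin t → ℝ} (hy : Monotone y) {j k : Fin ℓ} (h : j < k) :
    y j ≤ prev 0 y k := by
  rw [prev_eq, dif_neg (by have := Fin.lt_def.1 h; omega)]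
  exact hy (Fin.le_def.2 (by have := Fin.lt_def.1 h; simp only; omega))

lemma prev_le {y : Fin ℓ → Fin t → ℝ} (hy : Monotone y) (h0 : ∀ k, 0 ≤ y k) (k : Fin ℓ) :
    prev 0 y k ≤ y k := by
  rw [prev_eq]
  split_ifs with h
  · exact h0 k
  · exact hy (Fin.le_def.2 (by simp))

lemma prev_nonneg {y : Fin ℓ → Fin t → ℝ} (h0 : ∀ k, 0 ≤ y k) (k : Fin ℓ) :
    0 ≤ prev 0 y k := by
  rw [prev_eq]
  split_ifs with h
  · exact le_rfl
  · exact h0 _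

/-- In any one coordinate the boxes of a chain project to disjoint intervals, so their volumes add
up. -/
lemma cubeLaw_iUnion_openBox (ht : t ≠ 0) {y : Fin ℓ → Fin t → ℝ} (hy : Monotone y)
    (h0 : ∀ k, 0 ≤ y k) (h1 : ∀ k i, y k i ≤ 1) :
    cubeLaw t (⋃ k, openBox y k) = ENNReal.ofReal (boxVolume y) := by
  have hd : Pairwise (Function.onFun Disjoint (openBox y)) := by
    have key : ∀ j k, j < k → Disjoint (openBox y j) (openBox y k) := by
      intro j k hjk
      rw [Set.disjoint_left]
      intro x hx hx'
      have i : Fin t := ⟨0, Nat.pos_of_ne_zero ht⟩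
      have a1 := (hx i (mem_univ _)).2
      have a2 := (hx' i (mem_univ _)).1
      have a3 := le_prev_of_lt hy hjk i
      linarith
    intro j k hjk
    rcases lt_or_gt_of_ne hjk with h | h
    · exact key j k h
    · exact (key k j h).symm
  have hb : ∀ k i, 0 ≤ y k i - prev 0 y k i := fun k i => sub_nonneg.2 (prev_le hy h0 k i)
  rw [measure_iUnion hd (measurableSet_openBox y), tsum_fintype, boxVolume,
    ENNReal.ofReal_sum_of_nonneg fun k _ => Finset.prod_nonneg fun i _ => hb k i]
  refine Finset.sum_congr rfl fun k _ => ?_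
  rw [openBox, cubeLaw, Measure.pi_pi, ENNReal.ofReal_prod_of_nonneg fun i _ => hb k i]
  refine Finset.prod_congr rfl fun i _ => ?_
  rw [Measure.restrict_apply measurableSet_Ioo, inter_eq_left.2, Real.volume_Ioo]
  exact fun x hx => ⟨(prev_nonneg h0 k i).trans hx.1.le, hx.2.le.trans (h1 k i)⟩

open Classical in
/-- The indices outside of `range s` come after those of `s`. -/
noncomputable def splitEquiv (s : Fin ℓ ↪ Fin n) :
    Fin ℓ ⊕ {j // j ∉ range s} ≃ Fin n :=
  (Equiv.sumCongr (Equiv.ofInjective s s.injective) (Equiv.refl _)).trans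
    (Equiv.sumCompl (· ∈ range s))

lemma splitEquiv_inl (s : Fin ℓ ↪ Fin n) (k : Fin ℓ) : splitEquiv s (Sum.inl k) = s k := by
  simp [splitEquiv]

lemma splitEquiv_inr (s : Fin ℓ ↪ Fin n) (j : {j // j ∉ range s}) :
    splitEquiv s (Sum.inr j) = j := by
  simp [splitEquiv]

open Classical in
/-- Gluing the points of a chain and the remaining points. -/
noncomputable def glue (s : Fin ℓ ↪ Fin n) (α : Type*) [MeasurableSpace α] :
    (Fin ℓ → α) × ({j // j ∉ range s} → α) ≃ᵐ (Fin n → α) :=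
  (MeasurableEquiv.sumPiEquivProdPi fun _ : Fin ℓ ⊕ {j // j ∉ range s} => α).symm.trans
    (MeasurableEquiv.piCongrLeft (fun _ => α) (splitEquiv s))

lemma glue_apply_embedding (s : Fin ℓ ↪ Fin n) {α : Type*} [MeasurableSpace α] (y : Fin ℓ → α)
    (w : {j // j ∉ range s} → α) (k : Fin ℓ) : glue s α (y, w) (s k) = y k := by
  rw [← splitEquiv_inl s k]
  simp only [glue, MeasurableEquiv.trans_apply, MeasurableEquiv.coe_piCongrLeft,
    Equiv.piCongrLeft_apply_apply]
  rfl

lemma glue_apply_of_notMem (s : Fin ℓ ↪ Fin n) {α : Type*} [MeasurableSpace α] (y : Fin ℓ → α)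
    (w : {j // j ∉ range s} → α) (j : {j // j ∉ range s}) : glue s α (y, w) j = w j := by
  conv_lhs => rw [← splitEquiv_inr s j]
  simp only [glue, MeasurableEquiv.trans_apply, MeasurableEquiv.coe_piCongrLeft,
    Equiv.piCongrLeft_apply_apply]
  rfl

open Classical in
lemma measurePreserving_glue (s : Fin ℓ ↪ Fin n) (t : ℕ) :
    MeasurePreserving (glue s (Fin t → ℝ))
      ((Measure.pi fun _ => cubeLaw t).prod (Measure.pi fun _ => cubeLaw t)) (pointsLaw n t) :=
  (measurePreserving_piCongrLeft (fun _ : Fin n => cubeLaw t) (splitEquiv s)).comp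
    (measurePreserving_sumPiEquivProdPi_symm
      fun _ : Fin ℓ ⊕ {j // j ∉ range s} => cubeLaw t)

/-- By Fubini, fix the chain points `y`: the remaining points independently miss the union of boxes,
with probability `(1 - V)^{n-ℓ} ≤ e^{-(n-ℓ)V}`. -/
lemma pointsLaw_isMaximalChainSeq_le (ht : t ≠ 0) (hℓ : ℓ ≠ 0) {u : ℝ} (hu : u ∈ Ioo (0 : ℝ) 1)
    (A : ℝ) (s : Fin ℓ ↪ Fin n) :
    pointsLaw n t {X | IsMaximalChainSeq X s} ≤
      ENNReal.ofReal (chainBound t ℓ u A ((n : ℝ) - ℓ)) := by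
  classical
  have hcard : Fintype.card {j // j ∉ range s} + ℓ = n := by
    have := Fintype.card_congr (splitEquiv s)
    simp only [Fintype.card_sum, Fintype.card_fin] at this
    omega
  have hM : ((Fintype.card {j // j ∉ range s} : ℕ) : ℝ) = (n : ℝ) - ℓ := by
    rw [eq_sub_iff_add_eq]; exact_mod_cast hcard
  set S : Set (Fin ℓ → Fin t → ℝ) :=
    {y | (Monotone y) ∧ (∀ k, 0 ≤ y k) ∧ ∀ k i, y k i ≤ 1} with hSdef
  have hS : MeasurableSet S := by
    refine MeasurableSet.inter ?_ (MeasurableSet.inter ?_ ?_)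
    · change MeasurableSet {y : Fin ℓ → Fin t → ℝ | ∀ ⦃i j⦄, i ≤ j → y i ≤ y j}
      simp only [ ofPred_forall]
      exact MeasurableSet.iInter fun i => MeasurableSet.iInter fun j => MeasurableSet.iInter
        fun _ => measurableSet_le_pi (measurable_pi_apply _) (measurable_pi_apply _)
    · change MeasurableSet {y : Fin ℓ → Fin t → ℝ | ∀ k, 0 ≤ y k}
      simp only [ofPred_forall]
      exact MeasurableSet.iInter fun i =>
        measurableSet_le_pi measurable_const (measurable_pi_apply _)
    · change MeasurableSet {y : Fin ℓ → Fin t → ℝ | ∀ k i, y k i ≤ 1}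
      simp only [ofPred_forall]
      exact MeasurableSet.iInter fun k => MeasurableSet.iInter fun i => measurableSet_le
        ((measurable_pi_apply i).comp (measurable_pi_apply k)) measurable_const
  set C : Set (Fin ℓ → Fin t → ℝ) := univ.pi fun _ => univ.pi fun _ => Icc (0 : ℝ) 1 with hC
  have hCm : MeasurableSet C :=
    MeasurableSet.univ_pi fun _ => MeasurableSet.univ_pi fun _ => measurableSet_Icc
  rw [← (measurePreserving_glue s t).measure_preimage_equiv,
    Measure.prod_apply ((glue s _).measurable (measurableSet_isMaximalChainSeq s)), pi_cubeLaw_eq]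
  have hpt : ∀ y ∈ C, Measure.pi (fun _ : {j // j ∉ range s} => cubeLaw t)
      (Prod.mk y ⁻¹' (glue s (Fin t → ℝ) ⁻¹' {X | IsMaximalChainSeq X s})) ≤
      S.indicator (fun y => ENNReal.ofReal (Real.exp (-(((n : ℝ) - ℓ) * boxVolume y)))) y := by
    intro y hyC
    have h0 : ∀ k, 0 ≤ y k := fun k i => (hyC k (mem_univ _) i (mem_univ _)).1
    have h1 : ∀ k i, y k i ≤ 1 := fun k i => (hyC k (mem_univ _) i (mem_univ _)).2
    by_cases hmono : Monotone y
    · rw [indicator_of_mem (show y ∈ S from ⟨hmono, h0, h1⟩)]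
      have hU : MeasurableSet (⋃ k, openBox y k) :=
        MeasurableSet.iUnion (measurableSet_openBox y)
      calc _ ≤ Measure.pi (fun _ : {j // j ∉ range s} => cubeLaw t)
            (univ.pi fun _ => (⋃ k, openBox y k)ᶜ) := by
            refine measure_mono fun w hw j _ hj => ?_
            obtain ⟨k, hk⟩ := mem_iUnion.1 hj
            have hlow : lowerEnd (glue s (Fin t → ℝ) (y, w)) s k = prev 0 y k := by
              rw [lowerEnd_eq_prev]
              simp only [glue_apply_embedding]
            refine hw.2 k j j.2 ?_
            rw [hlow, glue_apply_embedding, glue_apply_of_notMem]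
            let i : Fin t := ⟨0, Nat.pos_of_ne_zero ht⟩
            exact ⟨Pi.lt_def.2 ⟨fun i => (hk i (mem_univ _)).1.le, i, (hk i (mem_univ _)).1⟩,
              Pi.lt_def.2 ⟨fun i => (hk i (mem_univ _)).2.le, i, (hk i (mem_univ _)).2⟩⟩
        _ = (1 - ENNReal.ofReal (boxVolume y)) ^ Fintype.card {j // j ∉ range s} := by
            rw [Measure.pi_pi, Finset.prod_const, Finset.card_univ, prob_compl_eq_one_sub hU,
              cubeLaw_iUnion_openBox ht hmono h0 h1]
        _ ≤ ENNReal.ofReal (Real.exp (-boxVolume y)) ^ Fintype.card {j // j ∉ range s} := by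
            refine pow_le_pow_left' ?_ _
            rw [← ENNReal.ofReal_one, ← ENNReal.ofReal_sub]
            · refine ENNReal.ofReal_le_ofReal ?_
              have := Real.add_one_le_exp (-boxVolume y)
              linarith
            · exact Finset.sum_nonneg fun k _ => Finset.prod_nonneg fun i _ =>
                sub_nonneg.2 (prev_le hmono h0 k i)
        _ = _ := by
            rw [← ENNReal.ofReal_pow (Real.exp_pos _).le, ← Real.exp_nat_mul, hM]
            ring_nf
    · refine le_trans (le_of_eq ?_) (zero_le)
      convert measure_empty (μ := Measure.pi fun _ : {j // j ∉ range s} => cubeLaw t)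
      refine eq_empty_of_forall_notMem fun w hw => hmono fun i j hij => ?_
      have := hw.1 i j hij
      rwa [glue_apply_embedding, glue_apply_embedding] at this
  calc _ ≤ ∫⁻ y in C, S.indicator
        (fun y => ENNReal.ofReal (Real.exp (-(((n : ℝ) - ℓ) * boxVolume y)))) y :=
        setLIntegral_mono' hCm hpt
    _ ≤ ∫⁻ y, S.indicator
        (fun y => ENNReal.ofReal (Real.exp (-(((n : ℝ) - ℓ) * boxVolume y)))) y :=
        setLIntegral_le_lintegral _ _
    _ = ∫⁻ y in S, ENNReal.ofReal (Real.exp (-(((n : ℝ) - ℓ) * boxVolume y))) :=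
        lintegral_indicator hS _
    _ ≤ _ := by
        refine lintegral_chains_le hℓ hu A ?_ hS (fun y hy => prev_le hy.1 hy.2.1)
          (fun y hy => hy.2.2)
        rw [← hM]; positivity

/-! ### The expected number of maximal chains. -/

open Classical in
lemma numMaximalChains_eq_sum (X : Fin n → Fin t → ℝ) :
    (numMaximalChains ℓ X : ℝ) =
      ∑ s : Fin ℓ ↪ Fin n, {X | IsMaximalChainSeq X s}.indicator (fun _ => (1 : ℝ)) X := by
  rw [numMaximalChains, Set.ncard_eq_toFinset_card']
  simp [indicator_apply, Finset.sum_boole]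

lemma integrable_numMaximalChains (n t ℓ : ℕ) :
    Integrable (fun X : Fin n → Fin t → ℝ => (numMaximalChains ℓ X : ℝ)) (pointsLaw n t) := by
  simp only [numMaximalChains_eq_sum]
  exact integrable_finsetSum _ fun s _ =>
    (integrable_const 1).indicator (measurableSet_isMaximalChainSeq s)

lemma integral_numMaximalChains_eq (n t ℓ : ℕ) :
    ∫ X : Fin n → Fin t → ℝ, (numMaximalChains ℓ X : ℝ) ∂(pointsLaw n t) =
      ∑ s : Fin ℓ ↪ Fin n, (pointsLaw n t).real {X | IsMaximalChainSeq X s} := by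
  simp only [numMaximalChains_eq_sum]
  rw [integral_finsetSum _ fun s _ =>
    (integrable_const 1).indicator (measurableSet_isMaximalChainSeq s)]
  refine Finset.sum_congr rfl fun s _ => ?_
  rw [integral_indicator_const _ (measurableSet_isMaximalChainSeq s)]
  simp

lemma chainBound_nonneg {u : ℝ} (hu : u < 1) (A M : ℝ) : 0 ≤ chainBound t ℓ u A M := by
  have := Real.Gamma_pos_of_pos (show 0 < 1 - u by linarith)
  unfold chainBound
  positivity

lemma integral_numMaximalChains_le (ht : t ≠ 0) (hℓ : ℓ ≠ 0) {u : ℝ} (hu : u ∈ Ioo (0 : ℝ) 1)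
    (A : ℝ) :
    ∫ X : Fin n → Fin t → ℝ, (numMaximalChains ℓ X : ℝ) ∂(pointsLaw n t) ≤
      (n : ℝ) ^ ℓ * chainBound t ℓ u A ((n : ℝ) - ℓ) := by
  rw [integral_numMaximalChains_eq]
  calc _ ≤ ∑ s : Fin ℓ ↪ Fin n, chainBound t ℓ u A ((n : ℝ) - ℓ) :=
        Finset.sum_le_sum fun s _ => ENNReal.toReal_le_of_le_ofReal (chainBound_nonneg hu.2 _ _)
          (pointsLaw_isMaximalChainSeq_le ht hℓ hu A s)
    _ ≤ _ := by
        rw [Finset.sum_const, nsmul_eq_mul, Finset.card_univ, Fintype.card_embedding_eq,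
          Fintype.card_fin, Fintype.card_fin]
        refine mul_le_mul_of_nonneg_right ?_ (chainBound_nonneg hu.2 _ _)
        exact_mod_cast Nat.descFactorial_le_pow n ℓ

/-! ### Longest chains are maximal chains. -/

lemma IsChainSeq.exists_insert {X : Fin n → Fin t → ℝ} {s : Fin ℓ ↪ Fin n} (hs : IsChainSeq X s)
    {k : Fin ℓ} {j : Fin n} (hj : j ∉ range s) (h1 : lowerEnd X s k < X j)
    (h2 : X j < X (s k)) : ∃ s' : Fin (ℓ + 1) ↪ Fin n, IsChainSeq X s' := by
  -- The new index takes position `k`; `s k` and its successors move up by one.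
  set f : Fin (ℓ + 1) → Fin n := k.castSucc.insertNth j s with hf
  have hfp : f k.castSucc = j := by simp [hf]
  have hfs : ∀ a, f (k.castSucc.succAbove a) = s a := fun a => by simp [hf]
  have hinj : Function.Injective f := by
    intro a b
    induction a using k.castSucc.succAboveCases with
    | x => induction b using k.castSucc.succAboveCases with
      | x => simp
      | p b =>
        rw [hfp, hfs]
        exact fun h => (hj ⟨b, h.symm⟩).elim
    | p a => induction b using k.castSucc.succAboveCases with
      | x =>
        rw [hfp, hfs]
        exact fun h => (hj ⟨a, h⟩).elim
      | p b =>
        rw [hfs, hfs]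
        exact fun h => by rw [s.injective h]
  refine ⟨⟨f, hinj⟩, fun a b => ?_⟩
  change a ≤ b → X (f a) ≤ X (f b)
  induction a using k.castSucc.succAboveCases with
  | x => induction b using k.castSucc.succAboveCases with
    | x => simp
    | p b =>
      intro h
      have hlt := lt_of_le_of_ne h (Fin.succAbove_ne _ _).symm
      rw [Fin.lt_succAbove_iff_le_castSucc, Fin.castSucc_le_castSucc_iff] at hlt
      rw [hfp, hfs]
      exact h2.le.trans (hs _ _ hlt)
  | p a => induction b using k.castSucc.succAboveCases with
    | x =>
      intro h
      have hlt := lt_of_le_of_ne h (Fin.succAbove_ne _ _)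
      rw [Fin.succAbove_lt_iff_castSucc_lt, Fin.castSucc_lt_castSucc_iff] at hlt
      rw [hfp, hfs]
      refine le_trans ?_ h1.le
      rw [lowerEnd_eq_prev]
      exact le_prev_of_lt (y := fun j => X (s j)) (fun a b hab => hs a b hab) hlt
    | p b =>
      intro h
      rw [Fin.succAbove_le_succAbove_iff] at h
      rw [hfs, hfs]
      exact hs _ _ h

lemma bddAbove_chainLengths (X : Fin n → Fin t → ℝ) :
    BddAbove {ℓ : ℕ | ∃ s : Fin ℓ ↪ Fin n, IsChainSeq X s} := by
  refine ⟨n, ?_⟩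
  rintro ℓ ⟨s, -⟩
  simpa using Fintype.card_le_of_embedding s

/-- A longest chain is maximal. -/
lemma exists_isMaximalChainSeq_longestChain (X : Fin n → Fin t → ℝ) :
    ∃ s : Fin (longestChain X) ↪ Fin n, IsMaximalChainSeq X s := by
  have hne : {ℓ : ℕ | ∃ s : Fin ℓ ↪ Fin n, IsChainSeq X s}.Nonempty :=
    ⟨0, ⟨Fin.elim0, fun i => i.elim0⟩, fun i => i.elim0⟩
  obtain ⟨s, hs⟩ : ∃ s : Fin (longestChain X) ↪ Fin n, IsChainSeq X s :=
    Nat.sSup_mem hne (bddAbove_chainLengths X)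
  refine ⟨s, hs, fun k j hj hlt => ?_⟩
  have := le_csSup (bddAbove_chainLengths X) (hs.exists_insert hj hlt.1 hlt.2)
  exact absurd this (Nat.not_succ_le_self _)

lemma longestChain_le (X : Fin n → Fin t → ℝ) : longestChain X ≤ n := by
  obtain ⟨s, -⟩ := exists_isMaximalChainSeq_longestChain X
  simpa using Fintype.card_le_of_embedding s

/-- A longest chain of length at least `m` is a maximal chain of some length between `m` and `n`.
For each of these at most `n + 1` lengths, the union bound over sequences is exactly `E[C_ℓ]`. -/
lemma one_sub_le_longestChain_lt (t : ℕ) (m B : ℝ)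
    (hB : ∀ ℓ : ℕ, m ≤ ℓ →
      ∫ X : Fin n → Fin t → ℝ, (numMaximalChains ℓ X : ℝ) ∂(pointsLaw n t) ≤ B) (hB0 : 0 ≤ B) :
    1 - (n + 1) * B ≤ (pointsLaw n t).real {X : Fin n → Fin t → ℝ | (longestChain X : ℝ) < m} := by
  classical
  set S := {X : Fin n → Fin t → ℝ | (longestChain X : ℝ) < m}
  have h1 : (1 : ℝ) ≤ (pointsLaw n t).real S + (pointsLaw n t).real Sᶜ := by
    have := measureReal_union_le (μ := pointsLaw n t) S Sᶜ
    rwa [union_compl_self, probReal_univ] at this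
  have hsub : Sᶜ ⊆ ⋃ ℓ ∈ (Finset.range (n + 1)).filter (fun ℓ : ℕ => m ≤ ℓ),
      ⋃ s : Fin ℓ ↪ Fin n, {X | IsMaximalChainSeq X s} := by
    intro X hX
    obtain ⟨s, hs⟩ := exists_isMaximalChainSeq_longestChain X
    refine mem_iUnion₂.2 ⟨longestChain X, ?_, mem_iUnion.2 ⟨s, hs⟩⟩
    rw [Finset.mem_filter, Finset.mem_range]
    exact ⟨Nat.lt_succ_of_le (longestChain_le X), not_lt.1 hX⟩
  have h2 : (pointsLaw n t).real Sᶜ ≤ (n + 1) * B := by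
    calc _ ≤ (pointsLaw n t).real (⋃ ℓ ∈ (Finset.range (n + 1)).filter (fun ℓ : ℕ => m ≤ ℓ),
          ⋃ s : Fin ℓ ↪ Fin n, {X | IsMaximalChainSeq X s}) := measureReal_mono hsub (measure_ne_top _ _)
      _ ≤ ∑ ℓ ∈ (Finset.range (n + 1)).filter (fun ℓ : ℕ => m ≤ ℓ),
          (pointsLaw n t).real (⋃ s : Fin ℓ ↪ Fin n, {X | IsMaximalChainSeq X s}) :=
          measureReal_biUnion_finset_le _ _
      _ ≤ ∑ ℓ ∈ (Finset.range (n + 1)).filter (fun ℓ : ℕ => m ≤ ℓ), B := by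
          refine Finset.sum_le_sum fun ℓ hℓ => ?_
          refine le_trans ?_ (hB ℓ (Finset.mem_filter.1 hℓ).2)
          rw [integral_numMaximalChains_eq]
          exact measureReal_iUnion_fintype_le _
      _ ≤ (n + 1) * B := by
          rw [Finset.sum_const, nsmul_eq_mul]
          refine mul_le_mul_of_nonneg_right ?_ hB0
          have := Finset.card_filter_le (Finset.range (n + 1)) (fun ℓ : ℕ => m ≤ ℓ)
          rw [Finset.card_range] at this
          exact_mod_cast this
  linarith

/-! ### Choice of parameters and exponential decay. -/

/-- The bound for the expected number of maximal chains, with `N` for `n ^ (1 / t)` and `lam` for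
`ℓ / (x N)`. -/
lemma pow_mul_chainBound_le {x a b u N lam : ℝ} (hx : 0 < x) (hb : 0 < b) (hu : u ∈ Ioo (0 : ℝ) 1)
    (hN : 0 < N) (hn : N ^ t = n) (hℓ : ℓ ≠ 0) (hlam : lam = ℓ / (x * N))
    (h1 : chernoff t a u ≤ (x / Real.exp 1) ^ t) (h2 : tau t x a b ≤ (x / Real.exp 1) ^ t) :
    (n : ℝ) ^ ℓ * chainBound t ℓ u (a + t * Real.log ((1 + b) * (x * N))) ((n : ℝ) - ℓ) ≤
      Real.exp (-(t * (1 - u) * (ℓ * Real.log lam))) +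
      Real.exp (-(t * (ℓ * Real.log lam)) +
        Real.exp (-a) / (x ^ t * (1 + b) ^ t) * (ℓ ^ 2 / n)) := by
  have hℓ0 : (0 : ℝ) < ℓ := by positivity
  have hn0 : (0 : ℝ) < n := hn ▸ by positivity
  have hG := Real.Gamma_pos_of_pos (show 0 < 1 - u by linarith [hu.2])
  have hB : 0 < Real.log (1 + b) := Real.log_pos (by linarith)
  -- All factors are written as exponentials, so that both bounds become inequalities between
  -- exponents.
  set G := Real.log (Real.Gamma (1 - u)) with hGdef
  set ll := Real.log ℓ with hll
  set Lx := Real.log x with hLx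
  set LN := Real.log N with hLN
  set Lb := Real.log (1 + b) with hLb
  have eG : Real.Gamma (1 - u) = Real.exp G := (Real.exp_log hG).symm
  have eℓ : (1 / (ℓ : ℝ)) = Real.exp (-ll) := by
    rw [Real.exp_neg, hll, Real.exp_log hℓ0, one_div]
  have ex : x = Real.exp Lx := (Real.exp_log hx).symm
  have eb : 1 + b = Real.exp Lb := (Real.exp_log (by linarith)).symm
  have eN : N = Real.exp LN := (Real.exp_log hN).symm
  have en : (n : ℝ) = Real.exp (t * LN) := by rw [← hn, Real.exp_nat_mul, ← eN]
  have hA : Real.log ((1 + b) * (x * N)) = Lb + (Lx + LN) := by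
    rw [Real.log_mul (by positivity) (by positivity), Real.log_mul hx.ne' hN.ne']
  have hl : Real.log lam = ll - (Lx + LN) := by
    rw [hlam, Real.log_div hℓ0.ne' (by positivity), Real.log_mul hx.ne' hN.ne']
  have ep : (x / Real.exp 1) ^ t = Real.exp (t * (Lx - 1)) := by
    rw [Real.exp_nat_mul, Real.exp_sub, ← ex]
  set D := Real.exp (-a) / (x ^ t * (1 + b) ^ t) with hD
  have eD : D = Real.exp (-a - t * Lx - t * Lb) := by
    rw [hD, Real.exp_sub, Real.exp_sub, Real.exp_nat_mul, Real.exp_nat_mul, ← ex, ← eb,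
      div_div]
  have h1' : t * G - a * u ≤ t * (Lx - 1) := by
    rw [ep, chernoff, eG, ← Real.exp_nat_mul, ← Real.exp_sub, Real.exp_le_exp] at h1
    exact h1
  have h2' : -D ≤ t * (Lx - 1) := by
    rw [ep, tau, Real.exp_le_exp] at h2
    exact h2
  have eA : Real.exp (-(a + t * (Lb + (Lx + LN)))) = D / n := by
    rw [eD, en, ← Real.exp_sub]; ring_nf
  rw [chainBound, hA, hl, eA, eℓ, eG, ← Real.exp_mul, ← Real.exp_add, ← Real.exp_nat_mul,
    ← Real.exp_nat_mul, ← Real.exp_add, ← Real.exp_add, mul_add, mul_add, ← Real.exp_add,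
    ← Real.exp_add]
  have en' : (n : ℝ) ^ ℓ = Real.exp (ℓ * (t * LN)) := by rw [Real.exp_nat_mul, ← en]
  rw [en', ← Real.exp_add, ← Real.exp_add]
  -- With `e^{-A} = D / n`, having `n - ℓ` instead of `n` free points costs `D ℓ² / n` in the
  -- exponent.
  have key : ((n : ℝ) - ℓ) * (ℓ * (D / n)) = ℓ * D - D * (ℓ ^ 2 / n) := by
    field_simp
  refine add_le_add (Real.exp_le_exp.2 ?_) (Real.exp_le_exp.2 ?_)
  · push_cast
    have e1 := mul_le_mul_of_nonneg_left h1' hℓ0.le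
    -- The Markov term carries an additional factor `(1 + b)^{-utℓ} ≤ 1`, which is dropped.
    have e2 : 0 ≤ (ℓ : ℝ) * (u * (t * Lb)) := by have := hu.1; positivity
    nlinarith
  · rw [key]
    push_cast
    have e1 := mul_le_mul_of_nonneg_left h2' hℓ0.le
    nlinarith

lemma integral_numMaximalChains_of_lt (h : n < ℓ) :
    ∫ X : Fin n → Fin t → ℝ, (numMaximalChains ℓ X : ℝ) ∂(pointsLaw n t) = 0 := by
  have : IsEmpty (Fin ℓ ↪ Fin n) :=
    ⟨fun s => absurd (Fintype.card_le_of_embedding s) (by simpa using h)⟩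
  rw [integral_numMaximalChains_eq]
  simp

/-- Uniform exponential bound for the expected number of maximal chains. -/
lemma exists_integral_numMaximalChains_le (ht : 2 ≤ t) :
    ∃ δ > 0, ∃ K ≥ 1, ∀ n : ℕ, n ≠ 0 → ∀ ε > 0, ∀ ℓ : ℕ,
      (xBar t + ε) * (n : ℝ) ^ ((1 : ℝ) / t) ≤ ℓ →
      ∫ X : Fin n → Fin t → ℝ, (numMaximalChains ℓ X : ℝ) ∂(pointsLaw n t) ≤
        K * Real.exp (-(δ * ε * (n : ℝ) ^ ((1 : ℝ) / t))) := by
  have ht0 : t ≠ 0 := by omega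
  set x := xBar t with hxdef
  have hx : 0 < x := xBar_pos ht0
  obtain ⟨⟨a, b⟩, hp, hab, hbt⟩ := exists_balanced (t := t) hx
  obtain ⟨u, hu, hru, -⟩ := exists_isMin_chernoff ht0 hp.1
  simp only at hab hbt hru
  have hb : 0 < b := hp.2
  have hq : beta b ≤ (x / Real.exp 1) ^ t := by
    have := qMin_xBar_le (t := t) ht0
    rw [← hxdef, ← qMax_eq_qMin_of_balanced ht0 hx hp hab hbt] at this
    exact ((le_max_left _ _).trans (le_max_right _ _)).trans this
  set D := Real.exp (-a) / (x ^ t * (1 + b) ^ t) with hD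
  have hD0 : 0 < D := by positivity
  have htpos : (0 : ℝ) < t := by positivity
  have hut : 0 < t * u := mul_pos htpos hu.1
  -- For `lam ≥ Λ` a part of the decay in `lam` absorbs the error `D ℓ² / n`; for `lam ≤ Λ` that
  -- error is bounded.
  set Λ := Real.exp (D / (t * u)) with hΛ
  refine ⟨t * (1 - u), mul_pos htpos (by linarith [hu.2]), 1 + Real.exp (D * (Λ * x) ^ 2),
    by have := Real.exp_pos (D * (Λ * x) ^ 2); linarith, fun n hn ε hε ℓ hℓ => ?_⟩
  set N := (n : ℝ) ^ ((1 : ℝ) / t) with hNdef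
  have hn1 : (1 : ℝ) ≤ n := by exact_mod_cast Nat.one_le_iff_ne_zero.2 hn
  have hN1 : 1 ≤ N := Real.one_le_rpow hn1 (by positivity)
  have hN : 0 < N := by linarith
  have hNt : N ^ t = n := by
    rw [hNdef, one_div]
    exact Real.rpow_inv_natCast_pow (by positivity) ht0
  rcases lt_or_ge n ℓ with hlt | hle
  · rw [integral_numMaximalChains_of_lt hlt]
    positivity
  have hℓ0 : (0 : ℝ) < ℓ := lt_of_lt_of_le (by positivity) hℓ
  have hℓne : ℓ ≠ 0 := by rintro rfl; simp at hℓ0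
  set lam := ℓ / (x * N) with hlam
  have hlam0 : 0 < lam := by positivity
  -- From `log lam ≥ 1 - 1 / lam` one gets `ℓ log lam ≥ ℓ - x N ≥ ε N`.
  have hlog : ε * N ≤ ℓ * Real.log lam := by
    have h1 := Real.one_sub_inv_le_log_of_pos hlam0
    have h2 : (ℓ : ℝ) * (1 - lam⁻¹) = ℓ - x * N := by
      rw [hlam, inv_div]; field_simp
    nlinarith
  refine (integral_numMaximalChains_le ht0 hℓne hu _).trans
    ((pow_mul_chainBound_le hx hb hu hN hNt hℓne hlam (hru ▸ hab ▸ hq) (hbt ▸ hq)).trans ?_)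
  -- For large `lam`, `ℓ ≤ n` gives `D ℓ² / n ≤ D ℓ`, at most the part `t u ℓ log lam` of the decay.
  -- Otherwise `ℓ ≤ Λ x N`, and `N² ≤ N^t = n` because `t ≥ 2`.
  have hR : -(t * u * (ℓ * Real.log lam)) + D * (ℓ ^ 2 / n) ≤ D * (Λ * x) ^ 2 := by
    have hlog0 : 0 ≤ ℓ * Real.log lam := le_trans (by positivity) hlog
    rcases le_or_gt D (t * u * Real.log lam) with h | h
    · have h3 : (ℓ : ℝ) ^ 2 / n ≤ ℓ := by
        rw [div_le_iff₀ (by linarith), sq]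
        exact mul_le_mul_of_nonneg_left (by exact_mod_cast hle) hℓ0.le
      have h4 := mul_le_mul_of_nonneg_left h3 hD0.le
      have h5 := mul_le_mul_of_nonneg_right h hℓ0.le
      have h6 : 0 ≤ D * (Λ * x) ^ 2 := by positivity
      nlinarith
    · have h3 : lam ≤ Λ := by
        rw [← Real.log_le_iff_le_exp hlam0, le_div_iff₀ hut]
        linarith
      have h4 : (ℓ : ℝ) ≤ Λ * x * N := by
        rw [hlam, div_le_iff₀ (by positivity)] at h3
        linarith
      have h5 : (ℓ : ℝ) ^ 2 / n ≤ (Λ * x) ^ 2 := by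
        rw [div_le_iff₀ (by linarith), ← hNt]
        calc (ℓ : ℝ) ^ 2 ≤ (Λ * x * N) ^ 2 := by gcongr
          _ = (Λ * x) ^ 2 * N ^ 2 := by ring
          _ ≤ (Λ * x) ^ 2 * N ^ t := by gcongr
      have h6 := mul_le_mul_of_nonneg_left h5 hD0.le
      have h7 := mul_nonneg hut.le hlog0
      linarith
  have hsplit : Real.exp (-(t * (ℓ * Real.log lam)) + D * (ℓ ^ 2 / n)) ≤
      Real.exp (-(t * (1 - u) * (ℓ * Real.log lam))) * Real.exp (D * (Λ * x) ^ 2) := by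
    rw [← Real.exp_add, Real.exp_le_exp]
    linarith
  calc _ ≤ Real.exp (-(t * (1 - u) * (ℓ * Real.log lam))) * (1 + Real.exp (D * (Λ * x) ^ 2)) := by
        linarith
    _ ≤ Real.exp (-(t * (1 - u) * ε * N)) * (1 + Real.exp (D * (Λ * x) ^ 2)) := by
        refine mul_le_mul_of_nonneg_right (Real.exp_le_exp.2 (neg_le_neg ?_)) (by positivity)
        rw [mul_assoc]
        exact mul_le_mul_of_nonneg_left hlog (mul_nonneg htpos.le (by linarith [hu.2]))
    _ = _ := by ring

lemma integral_numMaximalChains_zero_le (t ℓ : ℕ) :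
    ∫ X : Fin 0 → Fin t → ℝ, (numMaximalChains ℓ X : ℝ) ∂(pointsLaw 0 t) ≤ 1 := by
  rcases Nat.eq_zero_or_pos ℓ with rfl | h
  · rw [integral_numMaximalChains_eq, Fintype.sum_unique]
    exact measureReal_le_one
  · rw [integral_numMaximalChains_of_lt h]
    exact zero_le_one

end RandomChains

theorem theorem1 (t : ℕ) (ht : 2 < t) :
    ((∀ a : ℝ, Real.eulerMascheroniConstant * t < a → IsLeast (rhoValues t a) (rho t a)) ∧
      ∀ x : ℝ, 0 < x →
        (∀ p ∈ domainAB t, qMax t x p.1 p.2 < 1) ∧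
        qMin t x < 1 ∧
        ∃ p ∈ domainAB t,
          qMax t x p.1 p.2 = qMin t x ∧
          (∀ p' ∈ domainAB t, p' ≠ p → qMax t x p.1 p.2 < qMax t x p'.1 p'.2) ∧
          rho t p.1 = beta p.2 ∧ beta p.2 = tau t x p.1 p.2) ∧
    (goodX t).Nonempty ∧ xBar t < Real.exp 1 ∧
    ∃ c : ℝ, 0 < c ∧ ∀ ε : ℝ, 0 < ε → ∃ K : ℝ, ∀ n : ℕ,
      (∀ ℓ : ℕ, (xBar t + ε) * (n : ℝ) ^ ((1 : ℝ) / t) ≤ ℓ →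
        Integrable (fun X : Fin n → Fin t → ℝ => (numMaximalChains ℓ X : ℝ)) (pointsLaw n t) ∧
        ∫ X : Fin n → Fin t → ℝ, (numMaximalChains ℓ X : ℝ) ∂(pointsLaw n t) ≤
          K * Real.exp (-(c * ε * (n : ℝ) ^ ((1 : ℝ) / t)))) ∧
      1 - K * Real.exp (-(c * ε * (n : ℝ) ^ ((1 : ℝ) / t))) ≤
        (pointsLaw n t).real
          {X : Fin n → Fin t → ℝ |
            (longestChain X : ℝ) < (xBar t + ε) * (n : ℝ) ^ ((1 : ℝ) / t)} := by
  have ht0 : t ≠ 0 := by omega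
  refine ⟨⟨fun a ha => isLeast_rho ht0 ha, fun x hx => ⟨fun p hp => qMax_lt_one ht0 hx hp,
    qMin_lt_one ht0 hx, ?_⟩⟩, ⟨_, exp_one_mem_goodX ht0⟩, xBar_lt ht0, ?_⟩
  · obtain ⟨p, hp, h1, h2⟩ := exists_balanced (t := t) hx
    exact ⟨p, hp, qMax_eq_qMin_of_balanced ht0 hx hp h1 h2,
      fun p' hp' hne => qMax_lt_of_balanced ht0 hx hp h1 h2 hp' hne, h1, h2⟩
  obtain ⟨δ, hδ, K₀, hK₀, hmain⟩ := exists_integral_numMaximalChains_le (t := t) ht.le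
  -- Half of the rate is given up to absorb the factor `n + 1` from the union over lengths.
  refine ⟨δ / 2, by positivity, fun ε hε => ?_⟩
  -- From `y^t / t! ≤ e^y` at `y = δ ε N / 2`, where `N^t = n`, and `n + 1 ≤ 2n`.
  set C : ℝ := 2 * (t.factorial / (δ / 2 * ε) ^ t) with hC
  have hC0 : 0 < C := by positivity
  refine ⟨K₀ * (1 + C), fun n => ?_⟩
  have hK1 : K₀ ≤ K₀ * (1 + C) := le_mul_of_one_le_right (by linarith) (by linarith)
  -- For `n = 0` the exponentials equal `1`, and `K ≥ 1` makes both bounds trivial.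
  rcases Nat.eq_zero_or_pos n with rfl | hn
  · have hz : ((0 : ℕ) : ℝ) ^ ((1 : ℝ) / t) = 0 := by
      rw [Nat.cast_zero]; exact Real.zero_rpow (by positivity)
    rw [hz]
    simp only [mul_zero, neg_zero, Real.exp_zero, mul_one]
    exact ⟨fun ℓ _ => ⟨integrable_numMaximalChains 0 t ℓ,
      (integral_numMaximalChains_zero_le t ℓ).trans (by linarith)⟩,
      le_trans (by linarith) measureReal_nonneg⟩
  set N := (n : ℝ) ^ ((1 : ℝ) / t) with hNdef
  have hn1 : (1 : ℝ) ≤ n := by exact_mod_cast hn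
  have hN : 0 < N := by positivity
  have hNt : N ^ t = n := by
    rw [hNdef, one_div]
    exact Real.rpow_inv_natCast_pow (by positivity) ht0
  have hbound := hmain n hn.ne' ε hε
  have hexp : Real.exp (-(δ * ε * N)) ≤ Real.exp (-(δ / 2 * ε * N)) := by
    refine Real.exp_le_exp.2 (neg_le_neg ?_)
    have : 0 < δ * ε * N := by positivity
    linarith
  refine ⟨fun ℓ hℓ => ⟨integrable_numMaximalChains n t ℓ, (hbound ℓ hℓ).trans ?_⟩, ?_⟩
  · exact mul_le_mul hK1 hexp (Real.exp_pos _).le (by positivity)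
  refine le_trans (sub_le_sub_left ?_ 1)
    (one_sub_le_longestChain_lt t _ _ hbound (by positivity))
  have hpoly : (n : ℝ) + 1 ≤ C * Real.exp (δ / 2 * ε * N) := by
    have h := Real.pow_div_factorial_le_exp (δ / 2 * ε * N) (by positivity) t
    rw [mul_pow, hNt] at h
    have h2 : (2 : ℝ) * n = C * ((δ / 2 * ε) ^ t * n / t.factorial) := by
      rw [hC]
      have : (t.factorial : ℝ) ≠ 0 := by positivity
      have : (δ / 2 * ε) ^ t ≠ 0 := by positivity
      field_simp
    have h3 := mul_le_mul_of_nonneg_left h hC0.le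
    linarith
  have hsplit : Real.exp (δ / 2 * ε * N) * Real.exp (-(δ * ε * N)) =
      Real.exp (-(δ / 2 * ε * N)) := by
    rw [← Real.exp_add]; ring_nf
  calc ((n : ℝ) + 1) * (K₀ * Real.exp (-(δ * ε * N)))
      ≤ C * Real.exp (δ / 2 * ε * N) * (K₀ * Real.exp (-(δ * ε * N))) := by gcongr
    _ = K₀ * C * (Real.exp (δ / 2 * ε * N) * Real.exp (-(δ * ε * N))) := by ring
    _ = K₀ * C * Real.exp (-(δ / 2 * ε * N)) := by rw [hsplit]
    _ ≤ K₀ * (1 + C) * Real.exp (-(δ / 2 * ε * N)) := by gcongr; linarith
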